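/- **Setting.** Let $\Bbbk$ be $\mathbb{R}$ or $\mathbb{C}$. An *aromatic forest* is an isomorphism class of finite directed graphs (self-loops allowed, the empty graph $\mathbf 1$ included) in which every node has at most one outgoing edge; a *root* is a node without outgoing edge. Let $\mathcal{AF}$ be the set of aromatic forests, $\mathcal{AT}$ those with exactly one root, $\mathcal A$ those without roots, and $\mathcal F$ those without directed cycles. For $\phi\in\mathcal{AF}$ let $|\phi|$ be its number of nodes, $\sigma(\phi)$ the number of its graph automorphisms, and let concatenation $\phi\psi$ be the disjoint union. Let $H_{\mathcal F}$ be the free vector space on $\mathcal F$ with the concatenation product, $C_{\mathcal A}$ the free vector space on $\mathcal A$, and let $C_{\mathcal A}^*$ be its dual with the product $a\cdot b$ determined by $$\sum_{\gamma\in\mathcal A}\frac{(a\cdot b)(\gamma)}{\sigma(\gamma)}\gamma=\Big(\sum_{\gamma_1\in\mathcal A}\frac{a(\gamma_1)}{\sigma(\gamma_1)}\gamma_1\Big)\Big(\sum_{\gamma_2\in\mathcal A}\frac{b(\gamma_2)}{\sigma(\gamma_2)}\gamma_2\Big)$$ (formal multiplication of series) and the unit $\epsilon_{\mathcal A}$ given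 by $\epsilon_{\mathcal A}(\mathbf 1)=1$ and $\epsilon_{\mathcal A}(\gamma)=0$ for $\gamma\ne\mathbf 1$. A map $b:\mathcal{AF}\to\Bbbk$ induces the linear map $b':H_{\mathcal F}\to C_{\mathcal A}^*$, $\langle b'(\phi),\gamma\rangle=b(\gamma\phi)$ for $\phi\in\mathcal F$, $\gamma\in\mathcal A$. For smooth maps $f:\Bbbk^d\to\Bbbk^d$ and $G$ on $\Bbbk^d$ with values in a normed space over $\Bbbk$ (smooth over $\Bbbk$), put $$F_f(\phi)[G]=\sum_{i:V(\phi)\to\{1,\dots,d\}}\ \prod_{p\in V(\phi)}\Big(\prod_{q:(q,p)\in E(\phi)}\partial_{i_q}\Big)f^{i_p}\ \prod_{s\text{ root}}\partial_{i_s}G ,$$ where each factor indexed by $p$ is the indicated partial derivative of the component $f^{i_p}$. For $\tau\in\mathcal{AT}$, $F_f(\tau)$ is a first-order differential operator and is identified with a vector field. Define the formal power series in $h$ $$B_f(a)(y)=\sum_{\tau\in\mathcal{AT}}h^{|\tau|}\frac{a(\tau)}{\sigma(\tau)}F_f(\tau)(y),\qquad S_f(b)[G](y)=\sum_{\phi\in\mathcal{AF}}h^{|\phi|}\frac{b(\phi)}{\sigma(\phi)}F_f(\phi)[G](y).$$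 **Theorem 4.2.** Let $a:\mathcal{AT}\to\Bbbk$. There is exactly one map $\bar a:\mathcal{AF}\to\Bbbk$ that coincides with $a$ on $\mathcal{AT}$ and whose induced map $\bar a':H_{\mathcal F}\to C_{\mathcal A}^*$ is a morphism of unital algebras. For this $\bar a$, for all $d$, all smooth $f$ and $G$ as above, and all $y\in\Bbbk^d$, $$G\big(y+B_f(a)(y)\big)=S_f(\bar a)[G](y)$$ in the following two senses. (i) It is an identity of formal power series in $h$, where the left side is the formal composition $\sum_{k\ge0}\frac1{k!}G^{(k)}(y)\big(B_f(a)(y),\dots,B_f(a)(y)\big)$. (ii) It is an identity of asymptotic expansions: for every $N\ge 0$ and every $Y:\Bbbk\to\Bbbk^d$ such that, as $h\to0$, $Y(h)$ agrees with the truncation of $y+B_f(a)(y)$ at order $h^N$ up to $O(h^{N+1})$, the value $G(Y(h))$ agrees with the truncation of $S_f(\bar a)[G](y)$ at order $h^N$ up to $O(h^{N+1})$. -/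

import Mathlib

open Filter Topology Asymptotics
open scoped ContDiff

noncomputable section

/-! ### Directed graphs with at most one outgoing edge per node -/

/-- A directed graph on the vertex set `V` (self-loops allowed) in which every node has at most one
outgoing edge: `γ v = some w` means that `(v, w)` is the edge going out of `v`, and `γ v = none`
means that no edge goes out of `v`. -/
abbrev AromaticGraph (V : Type) : Type := V → Option V

namespace AromaticGraph

variable {V W U : Type}

/-- `(v, w)` is an edge of `γ`. -/
def Edge (γ : AromaticGraph V) (v w : V) : Prop := γ v = some w

/-- The bijection `e` maps the edge set of `γ` onto the edge set of `δ`. -/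
def IsIso (γ : AromaticGraph V) (δ : AromaticGraph W) (e : V ≃ W) : Prop :=
  ∀ v w, δ.Edge (e v) (e w) ↔ γ.Edge v w

theorem isIso_refl (γ : AromaticGraph V) : γ.IsIso γ (Equiv.refl V) := fun _ _ => Iff.rfl

theorem IsIso.symm {γ : AromaticGraph V} {δ : AromaticGraph W} {e : V ≃ W} (h : γ.IsIso δ e) :
    δ.IsIso γ e.symm := fun v w => by simpa using (h (e.symm v) (e.symm w)).symm

theorem IsIso.trans {γ : AromaticGraph V} {δ : AromaticGraph W} {ε : AromaticGraph U}
    {e : V ≃ W} {e' : W ≃ U} (h : γ.IsIso δ e) (h' : δ.IsIso ε e') : γ.IsIso ε (e.trans e') :=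
  fun v w => (h' (e v) (e w)).trans (h v w)

/-- The number of graph automorphisms of `γ`. -/
def autCard (γ : AromaticGraph V) : ℕ := Nat.card {e : Equiv.Perm V // γ.IsIso γ e}

/-- `γ` has no directed cycle (a self-loop is a directed cycle). -/
def Loopless (γ : AromaticGraph V) : Prop := ∀ v, ¬ Relation.TransGen γ.Edge v v

theorem IsIso.autCard_eq {γ : AromaticGraph V} {δ : AromaticGraph W} {e : V ≃ W}
    (h : γ.IsIso δ e) : γ.autCard = δ.autCard :=
  Nat.card_congr
    { toFun := fun g => ⟨(e.symm.trans g.1).trans e, (h.symm.trans g.2).trans h⟩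
      invFun := fun g => ⟨(e.trans g.1).trans e.symm, (h.trans g.2).trans h.symm⟩
      left_inv := fun g => by ext; simp
      right_inv := fun g => by ext; simp }

theorem IsIso.loopless {γ : AromaticGraph V} {δ : AromaticGraph W} {e : V ≃ W}
    (h : γ.IsIso δ e) (hδ : δ.Loopless) : γ.Loopless := fun v hv =>
  hδ (e v) (hv.lift e fun a b hab => (h a b).2 hab)

/-- The disjoint union of two graphs. -/
def disjointUnion (γ : AromaticGraph V) (δ : AromaticGraph W) : AromaticGraph (V ⊕ W) :=
  Sum.elim (fun v => (γ v).map Sum.inl) (fun w => (δ w).map Sum.inr)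

/-- Relabelling of the vertices along a bijection. -/
def relabel (e : V ≃ W) (γ : AromaticGraph V) : AromaticGraph W :=
  fun w => (γ (e.symm w)).map e

theorem isIso_relabel (e : V ≃ W) (γ : AromaticGraph V) : γ.IsIso (γ.relabel e) e := by
  intro v w
  simp [Edge, relabel]

theorem IsIso.disjointUnion {V' W' : Type} {γ : AromaticGraph V} {γ' : AromaticGraph V'}
    {δ : AromaticGraph W} {δ' : AromaticGraph W'} {e : V ≃ V'} {e' : W ≃ W'}
    (h : γ.IsIso γ' e) (h' : δ.IsIso δ' e') :
    (γ.disjointUnion δ).IsIso (γ'.disjointUnion δ') (Equiv.sumCongr e e') := by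
  rintro (v | v) (w | w)
  · simpa [Edge, AromaticGraph.disjointUnion] using h v w
  · simp [Edge, AromaticGraph.disjointUnion]
  · simp [Edge, AromaticGraph.disjointUnion]
  · simpa [Edge, AromaticGraph.disjointUnion] using h' v w

theorem Loopless.disjointUnion {γ : AromaticGraph V} {δ : AromaticGraph W}
    (h : γ.Loopless) (h' : δ.Loopless) : (γ.disjointUnion δ).Loopless := by
  have key : ∀ a b, Relation.TransGen (γ.disjointUnion δ).Edge a b →
      (∀ v, a = Sum.inl v → ∃ w, b = Sum.inl w ∧ Relation.TransGen γ.Edge v w) ∧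
      (∀ v, a = Sum.inr v → ∃ w, b = Sum.inr w ∧ Relation.TransGen δ.Edge v w) := by
    intro a b hab
    have step : ∀ x y, (γ.disjointUnion δ).Edge x y →
        (∀ v, x = Sum.inl v → ∃ w, y = Sum.inl w ∧ γ.Edge v w) ∧
        (∀ v, x = Sum.inr v → ∃ w, y = Sum.inr w ∧ δ.Edge v w) := by
      rintro (x | x) (y | y) hxy <;> simp_all [Edge, AromaticGraph.disjointUnion]
    induction hab with
    | single hb =>
      refine ⟨fun v hv => ?_, fun v hv => ?_⟩
      · obtain ⟨w, hw, e⟩ := (step _ _ hb).1 v hv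
        exact ⟨w, hw, .single e⟩
      · obtain ⟨w, hw, e⟩ := (step _ _ hb).2 v hv
        exact ⟨w, hw, .single e⟩
    | tail _ hb ih =>
      refine ⟨fun v hv => ?_, fun v hv => ?_⟩
      · obtain ⟨w, hw, e⟩ := ih.1 v hv
        obtain ⟨w', hw', e'⟩ := (step _ _ hb).1 w hw
        exact ⟨w', hw', e.tail e'⟩
      · obtain ⟨w, hw, e⟩ := ih.2 v hv
        obtain ⟨w', hw', e'⟩ := (step _ _ hb).2 w hw
        exact ⟨w', hw', e.tail e'⟩
  rintro (v | v) hv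
  · obtain ⟨w, hw, e⟩ := (key _ _ hv).1 v rfl
    cases hw
    exact h _ e
  · obtain ⟨w, hw, e⟩ := (key _ _ hv).2 v rfl
    cases hw
    exact h' _ e

variable [Fintype V] [DecidableEq V] [Fintype W] [DecidableEq W]

/-- The roots: the nodes without an outgoing edge. -/
def roots (γ : AromaticGraph V) : Finset V := Finset.univ.filter fun v => γ v = none

/-- The direct predecessors of the node `p`. -/
def predecessors (γ : AromaticGraph V) (p : V) : Finset V :=
  Finset.univ.filter fun q => γ q = some p

theorem mem_roots_iff (γ : AromaticGraph V) (v : V) : v ∈ γ.roots ↔ ∀ w, ¬ γ.Edge v w := by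
  simp [roots, Edge, Option.eq_none_iff_forall_ne_some]

theorem IsIso.roots_eq {γ : AromaticGraph V} {δ : AromaticGraph W} {e : V ≃ W}
    (h : γ.IsIso δ e) : δ.roots = γ.roots.map e.toEmbedding := by
  ext w
  obtain ⟨v, rfl⟩ := e.surjective w
  simp only [Finset.mem_map_equiv, Equiv.symm_apply_apply, mem_roots_iff]
  rw [← e.forall_congr_right]
  simp [h v]

theorem IsIso.predecessors_eq {γ : AromaticGraph V} {δ : AromaticGraph W} {e : V ≃ W}
    (h : γ.IsIso δ e) (p : V) : δ.predecessors (e p) = (γ.predecessors p).map e.toEmbedding := by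
  ext w
  obtain ⟨v, rfl⟩ := e.surjective w
  simpa [predecessors, Finset.mem_map_equiv, Edge] using h v p

end AromaticGraph

/-! ### Aromatic forests -/

/-- Equivalence of graphs with the vertex set `{0, …, n - 1}`. -/
def aromaticSetoid (n : ℕ) : Setoid (AromaticGraph (Fin n)) where
  r γ δ := ∃ e : Fin n ≃ Fin n, γ.IsIso δ e
  iseqv := ⟨fun γ => ⟨_, γ.isIso_refl⟩, fun ⟨_, h⟩ => ⟨_, h.symm⟩,
    fun ⟨_, h⟩ ⟨_, h'⟩ => ⟨_, h.trans h'⟩⟩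

/-- An aromatic forest: an equivalence class of finite directed graphs where each node has at most
one outgoing edge. It consists of its number of nodes and an equivalence class of graphs on
`{0, …, n - 1}`. The empty graph is allowed. -/
def AromaticForest : Type := Σ n : ℕ, Quotient (aromaticSetoid n)

instance (n : ℕ) : Finite (Quotient (aromaticSetoid n)) := Quotient.finite _

instance (n : ℕ) : Fintype (Quotient (aromaticSetoid n)) := Fintype.ofFinite _

namespace AromaticForest

/-- The number of nodes. -/
def size (φ : AromaticForest) : ℕ := φ.1

/-- The class of a graph on `{0, …, n - 1}`. -/
def mk {n : ℕ} (γ : AromaticGraph (Fin n)) : AromaticForest := ⟨n, Quotient.mk _ γ⟩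

/-- The normalization constant: the size of the graph automorphism group. -/
def sigma (φ : AromaticForest) : ℕ :=
  Quotient.lift (s := aromaticSetoid φ.1) (fun γ => γ.autCard)
    (fun _ _ ⟨_, h⟩ => h.autCard_eq) φ.2

/-- The number of roots. -/
def numRoots (φ : AromaticForest) : ℕ :=
  Quotient.lift (s := aromaticSetoid φ.1) (fun γ => γ.roots.card)
    (fun _ _ ⟨_, h⟩ => by simp only [h.roots_eq, Finset.card_map]) φ.2

/-- The forest has no directed cycle. -/
def IsLoopless (φ : AromaticForest) : Prop :=
  Quotient.lift (s := aromaticSetoid φ.1) (fun γ => γ.Loopless)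
    (fun _ _ ⟨_, h⟩ => propext ⟨h.symm.loopless, h.loopless⟩) φ.2

/-- The empty forest. -/
instance : One AromaticForest := ⟨mk (n := 0) Fin.elim0⟩

/-- Concatenation: the disjoint union of the two graphs. -/
instance : Mul AromaticForest :=
  ⟨fun φ ψ => ⟨φ.1 + ψ.1,
    Quotient.map₂ (sa := aromaticSetoid φ.1) (sb := aromaticSetoid ψ.1)
      (sc := aromaticSetoid (φ.1 + ψ.1))
      (fun γ δ => (γ.disjointUnion δ).relabel finSumFinEquiv)
      (fun _ _ ⟨_, h⟩ _ _ ⟨_, h'⟩ =>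
        ⟨_, ((AromaticGraph.isIso_relabel finSumFinEquiv _).symm.trans
          (h.disjointUnion h')).trans (AromaticGraph.isIso_relabel finSumFinEquiv _)⟩)
      φ.2 ψ.2⟩⟩

theorem isLoopless_one : (1 : AromaticForest).IsLoopless := fun v => v.elim0

theorem IsLoopless.mul {φ ψ : AromaticForest} (hφ : φ.IsLoopless) (hψ : ψ.IsLoopless) :
    (φ * ψ).IsLoopless := by
  obtain ⟨m, φ⟩ := φ
  obtain ⟨n, ψ⟩ := ψ
  induction φ using Quotient.inductionOn
  induction ψ using Quotient.inductionOn
  exact (AromaticGraph.isIso_relabel finSumFinEquiv _).symm.loopless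
    (AromaticGraph.Loopless.disjointUnion hφ hψ)

/-- The finite set of all aromatic forests with `n` nodes. -/
def ofSize (n : ℕ) : Finset AromaticForest :=
  (Finset.univ : Finset (Quotient (aromaticSetoid n))).map ⟨Sigma.mk n, sigma_mk_injective⟩

end AromaticForest

/-- The aromatic forests without roots. -/
abbrev RootlessForest : Type := {φ : AromaticForest // φ.numRoots = 0}

/-- The aromatic trees: the aromatic forests with exactly one root. -/
abbrev AromaticTree : Type := {φ : AromaticForest // φ.numRoots = 1}

/-- The (loopless) forests, that is, the multisets of rooted trees. -/
abbrev LooplessForest : Type := {φ : AromaticForest // φ.IsLoopless}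

instance : One LooplessForest := ⟨⟨1, AromaticForest.isLoopless_one⟩⟩

instance : Mul LooplessForest := ⟨fun φ ψ => ⟨φ.1 * ψ.1, φ.2.mul ψ.2⟩⟩

/-! ### The algebra of forests and the dual of the coalgebra of rootless forests -/

section Algebra

variable (𝕜 : Type) [Field 𝕜]

/-- The free vector space over the loopless forests; as a monoid algebra it carries
the concatenation product. -/
abbrev ForestAlgebra : Type := MonoidAlgebra 𝕜 LooplessForest

/-- The linear dual of the free vector space over the rootless forests. -/
abbrev RootlessDual : Type := Module.Dual 𝕜 (RootlessForest →₀ 𝕜)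

variable {𝕜}

/-- The value of a linear form on a rootless forest. -/
def RootlessDual.coeff (a : RootlessDual 𝕜) (γ : RootlessForest) : 𝕜 := a (Finsupp.single γ 1)

open Classical in
/-- The pairs of rootless forests whose concatenation is `γ`. -/
def rootlessFactorizations (γ : RootlessForest) : Finset (RootlessForest × RootlessForest) :=
  ((Finset.HasAntidiagonal.antidiagonal γ.1.size).biUnion fun mn =>
    ((AromaticForest.ofSize mn.1).subtype fun φ => φ.numRoots = 0) ×ˢ
      ((AromaticForest.ofSize mn.2).subtype fun φ => φ.numRoots = 0)).filter
    fun p => p.1.1 * p.2.1 = γ.1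

theorem mem_rootlessFactorizations (γ : RootlessForest) (p : RootlessForest × RootlessForest) :
    p ∈ rootlessFactorizations γ ↔ p.1.1 * p.2.1 = γ.1 := by
  have hmem : ∀ φ : AromaticForest, φ ∈ AromaticForest.ofSize φ.size := fun φ => by
    simp only [AromaticForest.ofSize, Finset.mem_map, Finset.mem_univ, true_and]
    exact ⟨φ.2, rfl⟩
  simp only [rootlessFactorizations, Finset.mem_filter, Finset.mem_biUnion, Finset.mem_product,
    Finset.mem_subtype, Finset.HasAntidiagonal.mem_antidiagonal, and_iff_right_iff_imp]
  intro h
  refine ⟨(p.1.1.size, p.2.1.size), ?_, hmem _, hmem _⟩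
  rw [← h]
  rfl

/-- The product on the dual of the coalgebra of rootless forests: `a · b` is determined by
`∑ (a · b)(γ) / σ(γ) γ = (∑ a(γ₁) / σ(γ₁) γ₁) (∑ b(γ₂) / σ(γ₂) γ₂)`,
with formal multiplication of series on the right. -/
def RootlessDual.mul (a b : RootlessDual 𝕜) : RootlessDual 𝕜 :=
  Finsupp.linearCombination 𝕜 fun γ : RootlessForest =>
    (γ.1.sigma : 𝕜) * ∑ p ∈ rootlessFactorizations γ,
      (a.coeff p.1 / (p.1.1.sigma : 𝕜)) * (b.coeff p.2 / (p.2.1.sigma : 𝕜))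

open Classical in
/-- The unit of the dual of the coalgebra of rootless forests: the counit, which maps the empty
forest to `1` and every other rootless forest to `0`. -/
def RootlessDual.one : RootlessDual 𝕜 :=
  Finsupp.linearCombination 𝕜 fun γ : RootlessForest => if γ.1 = 1 then (1 : 𝕜) else 0

/-- The linear map from the algebra of forests to the dual of the coalgebra of rootless forests
induced by a series `a` over the aromatic forests: `⟨a'(φ), γ⟩ = a(γ φ)`. -/
def inducedMap (a : AromaticForest → 𝕜) : ForestAlgebra 𝕜 →ₗ[𝕜] RootlessDual 𝕜 :=
  (Finsupp.linearCombination 𝕜 fun φ : LooplessForest =>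
    (Finsupp.linearCombination 𝕜 fun γ : RootlessForest => a (γ.1 * φ.1) :
      RootlessDual 𝕜)) ∘ₗ (MonoidAlgebra.coeffLinearEquiv 𝕜).toLinearMap

/-- A linear map from the algebra of forests to the dual of the coalgebra of rootless forests is
a morphism of (unital) algebras. -/
structure IsAlgebraMorphism (L : ForestAlgebra 𝕜 →ₗ[𝕜] RootlessDual 𝕜) : Prop where
  map_one : L 1 = RootlessDual.one
  map_mul : ∀ x y, L (x * y) = (L x).mul (L y)

/-- `b` coincides with `a` on the aromatic trees, and the linear map induced by `b` is an algebra
morphism. -/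
structure IsMultiplicativeExtension (a : AromaticTree → 𝕜) (b : AromaticForest → 𝕜) : Prop where
  eq_on_trees : ∀ τ : AromaticTree, b τ.1 = a τ
  isAlgebraMorphism : IsAlgebraMorphism (inducedMap b)

end Algebra

/-! ### Elemental differential operators -/

section Analysis

variable {𝕜 : Type} [RCLike 𝕜] {d : ℕ} {W : Type*} [NormedAddCommGroup W] [NormedSpace 𝕜 W]

/-- The partial derivative `∂^I H` at `y`, where the multiindex `I` is given as the multiset of the
coordinate directions. -/
def multiPartial (I : Multiset (Fin d)) (H : (Fin d → 𝕜) → W) (y : Fin d → 𝕜) : W :=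
  iteratedFDeriv 𝕜 I.sort.length H y fun j => Pi.single (I.sort.get j) 1

/-- The elemental differential operator of a graph, applied to `G` at `y`: the sum over all
assignments `i` of coordinate indices to the nodes of
`(∏ p, f^{i_p}_{I_{π(p)}}) ∏ s root, ∂_{i_s} G`. -/
def AromaticGraph.elementalOp {V : Type} [Fintype V] [DecidableEq V] (γ : AromaticGraph V)
    (f : (Fin d → 𝕜) → (Fin d → 𝕜)) (G : (Fin d → 𝕜) → W) (y : Fin d → 𝕜) : W :=
  ∑ i : V → Fin d,
    (∏ p : V, multiPartial ((γ.predecessors p).val.map i) (fun x => f x (i p)) y) •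
      multiPartial (γ.roots.val.map i) G y

theorem AromaticGraph.IsIso.elementalOp_eq {V V' : Type} [Fintype V] [DecidableEq V] [Fintype V']
    [DecidableEq V'] {γ : AromaticGraph V} {δ : AromaticGraph V'} {e : V ≃ V'} (h : γ.IsIso δ e)
    (f : (Fin d → 𝕜) → (Fin d → 𝕜)) (G : (Fin d → 𝕜) → W) (y : Fin d → 𝕜) :
    γ.elementalOp f G y = δ.elementalOp f G y := by
  unfold AromaticGraph.elementalOp
  refine Fintype.sum_equiv (Equiv.arrowCongr e (Equiv.refl _)) _ _ fun i => ?_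
  congr 1
  · refine Fintype.prod_equiv e _ _ fun p => ?_
    simp [h.predecessors_eq, Multiset.map_map, Function.comp_def]
  · simp [h.roots_eq, Multiset.map_map, Function.comp_def]

namespace AromaticForest

/-- The elemental differential operator `F_f(φ)`, applied to `G` at `y`. -/
def elementalOp (φ : AromaticForest) (f : (Fin d → 𝕜) → (Fin d → 𝕜)) (G : (Fin d → 𝕜) → W)
    (y : Fin d → 𝕜) : W :=
  Quotient.lift (s := aromaticSetoid φ.1) (fun γ => γ.elementalOp f G y)
    (fun _ _ ⟨_, h⟩ => h.elementalOp_eq f G y) φ.2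

end AromaticForest

/-- The elemental vector field of an aromatic tree: the vector field whose components are obtained
by applying the first-order differential operator `F_f(τ)` to the coordinate functions. -/
def elementalField (τ : AromaticTree) (f : (Fin d → 𝕜) → (Fin d → 𝕜))
    (y : Fin d → 𝕜) : Fin d → 𝕜 :=
  fun c => τ.1.elementalOp f (fun x => x c) y

/-! ### Aromatic B-series and S-series as formal power series in the step size -/

/-- The coefficient of `h ^ n` in the aromatic B-series
`B_f(a)(y) = ∑ τ, h ^ |τ| * a(τ) / σ(τ) * F_f(τ)(y)`. -/
def bSeries (f : (Fin d → 𝕜) → (Fin d → 𝕜)) (a : AromaticTree → 𝕜) (y : Fin d → 𝕜) (n : ℕ) :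
    Fin d → 𝕜 :=
  ∑ τ ∈ (AromaticForest.ofSize n).subtype fun φ => φ.numRoots = 1,
    (a τ / (τ.1.sigma : 𝕜)) • elementalField τ f y

/-- The coefficient of `h ^ n` in the aromatic S-series
`S_f(b)[G](y) = ∑ φ, h ^ |φ| * b(φ) / σ(φ) * F_f(φ)[G](y)`. -/
def sSeries (f : (Fin d → 𝕜) → (Fin d → 𝕜)) (b : AromaticForest → 𝕜) (G : (Fin d → 𝕜) → W)
    (y : Fin d → 𝕜) (n : ℕ) : W :=
  ∑ φ ∈ AromaticForest.ofSize n, (b φ / (φ.sigma : 𝕜)) • φ.elementalOp f G y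

/-- The formal power series `y + B_f(a)(y)`. -/
def shiftedBSeries (f : (Fin d → 𝕜) → (Fin d → 𝕜)) (a : AromaticTree → 𝕜) (y : Fin d → 𝕜) (n : ℕ) :
    Fin d → 𝕜 :=
  (if n = 0 then y else 0) + bSeries f a y n

variable (𝕜) in
/-- The coefficient of `h ^ n` in the formal power series `G(Y)`, where `Y = ∑ h ^ m Y_m` is a
formal power series: with `R = Y - Y_0`, this is the coefficient of `h ^ n` in the Taylor series
`∑ k, 1 / k! * G^(k)(Y_0)(R, …, R)`. As `R` has no constant term, only `k ≤ n` contribute. -/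
def formalComp (G : (Fin d → 𝕜) → W) (Y : ℕ → Fin d → 𝕜) (n : ℕ) : W :=
  ∑ k ∈ Finset.range (n + 1), ((k.factorial : 𝕜)⁻¹) •
    ∑ m ∈ (Finset.Nat.antidiagonalTuple k n).filter (fun m => ∀ j, m j ≠ 0),
      iteratedFDeriv 𝕜 k G (Y 0) fun j => Y (m j)

variable (𝕜) in
/-- `u h` has the asymptotic expansion `∑ h ^ n c_n` as `h → 0` up to order `N`, that is, with
an error `O(h ^ (N + 1))`. -/
def HasExpansionUpTo {X : Type*} [NormedAddCommGroup X] [NormedSpace 𝕜 X] (u : 𝕜 → X) (c : ℕ → X)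
    (N : ℕ) : Prop :=
  (fun h : 𝕜 => u h - ∑ n ∈ Finset.range (N + 1), h ^ n • c n) =O[𝓝 0] fun h : 𝕜 => h ^ (N + 1)

end Analysis

end

noncomputable section

namespace AromaticGraph

variable {V W U : Type}

theorem isIso_iff_map {γ : AromaticGraph V} {δ : AromaticGraph W} {e : V ≃ W} :
    γ.IsIso δ e ↔ ∀ v, δ (e v) = (γ v).map e := by
  constructor
  · intro h v
    ext w
    obtain ⟨w, rfl⟩ := e.surjective w
    simpa [Edge] using h v w
  · intro h v w
    simp [Edge, h]

/-- The subgraph induced on the set `S` of vertices. -/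
def restrict (γ : AromaticGraph V) (S : Set V) : AromaticGraph S := by
  classical exact fun v => (γ v).bind fun w => if h : w ∈ S then some ⟨w, h⟩ else none

theorem edge_restrict {γ : AromaticGraph V} {S : Set V} {v w : S} :
    (γ.restrict S).Edge v w ↔ γ.Edge v w := by
  simp only [Edge, restrict, Option.bind_eq_some_iff]
  constructor
  · rintro ⟨x, hx, h⟩
    split_ifs at h with hS
    cases h
    exact hx
  · intro h
    exact ⟨w, h, by simp⟩

/-- The vertex set `S` is a union of connected components. -/
def IsClopen (γ : AromaticGraph V) (S : Set V) : Prop :=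
  ∀ v w, γ.Edge v w → (v ∈ S ↔ w ∈ S)

theorem IsClopen.compl {γ : AromaticGraph V} {S : Set V} (h : γ.IsClopen S) : γ.IsClopen Sᶜ :=
  fun v w e => not_congr (h v w e)

theorem IsClopen.union {γ : AromaticGraph V} {S T : Set V} (h : γ.IsClopen S)
    (h' : γ.IsClopen T) : γ.IsClopen (S ∪ T) :=
  fun v w e => or_congr (h v w e) (h' v w e)

theorem IsClopen.restrict_eq_none {γ : AromaticGraph V} {S : Set V} (h : γ.IsClopen S) (v : S) :
    γ.restrict S v = none ↔ γ v = none := by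
  simp only [Option.eq_none_iff_forall_ne_some]
  constructor
  · intro hv w hw
    exact hv ⟨w, (h v w hw).1 v.2⟩ (edge_restrict.2 hw)
  · intro hv w hw
    exact hv w (edge_restrict.1 hw)

theorem edge_disjointUnion_inl {γ : AromaticGraph V} {δ : AromaticGraph W} {v w : V} :
    (γ.disjointUnion δ).Edge (.inl v) (.inl w) ↔ γ.Edge v w := by
  simp [Edge, disjointUnion]

theorem edge_disjointUnion_inr {γ : AromaticGraph V} {δ : AromaticGraph W} {v w : W} :
    (γ.disjointUnion δ).Edge (.inr v) (.inr w) ↔ δ.Edge v w := by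
  simp [Edge, disjointUnion]

theorem not_edge_disjointUnion_inl_inr {γ : AromaticGraph V} {δ : AromaticGraph W} {v : V}
    {w : W} : ¬ (γ.disjointUnion δ).Edge (.inl v) (.inr w) := by
  simp [Edge, disjointUnion]

theorem not_edge_disjointUnion_inr_inl {γ : AromaticGraph V} {δ : AromaticGraph W} {v : W}
    {w : V} : ¬ (γ.disjointUnion δ).Edge (.inr v) (.inl w) := by
  simp [Edge, disjointUnion]

theorem roots_disjointUnion [Fintype V] [DecidableEq V] [Fintype W] [DecidableEq W]
    (γ : AromaticGraph V) (δ : AromaticGraph W) :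
    (γ.disjointUnion δ).roots = γ.roots.disjSum δ.roots := by
  ext (v | v) <;> simp only [roots, Finset.mem_filter, Finset.mem_univ, true_and,
    Finset.inl_mem_disjSum, Finset.inr_mem_disjSum] <;> simp [disjointUnion]

theorem IsClopen.isIso_sumCompl {γ : AromaticGraph V} {S : Set V} [DecidablePred (· ∈ S)]
    (h : γ.IsClopen S) :
    ((γ.restrict S).disjointUnion (γ.restrict Sᶜ)).IsIso γ (Equiv.Set.sumCompl S) := by
  rintro (v | v) (w | w)
  · simp [edge_disjointUnion_inl, edge_restrict]
  · simp only [not_edge_disjointUnion_inl_inr, iff_false]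
    exact fun e => w.2 ((h _ _ e).1 v.2)
  · simp only [not_edge_disjointUnion_inr_inl, iff_false]
    exact fun e => v.2 ((h _ _ e).2 w.2)
  · simp [edge_disjointUnion_inr, edge_restrict]

/-- A graph embedded in `γ` with range `S` is isomorphic to the subgraph induced on `S`. -/
theorem exists_isIso_restrict {γ : AromaticGraph V} {δ : AromaticGraph W} {S : Set V} (g : W → V)
    (hg : Function.Injective g) (he : ∀ v w, γ.Edge (g v) (g w) ↔ δ.Edge v w)
    (hS : ∀ v, v ∈ S ↔ ∃ w, g w = v) :
    ∃ e : W ≃ S, δ.IsIso (γ.restrict S) e ∧ ∀ w, (e w : V) = g w := by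
  obtain rfl : Set.range g = S := by ext v; simp [hS]
  exact ⟨Equiv.ofInjective g hg, fun v w => by simp [edge_restrict, he], fun w => rfl⟩

end AromaticGraph

namespace AromaticForest

open AromaticGraph

variable {V W U : Type} [Finite V] [Finite W] [Finite U]

/-- The isomorphism class of a finite graph. -/
def of (γ : AromaticGraph V) : AromaticForest := mk (γ.relabel (Finite.equivFin V))

theorem mk_eq_mk_iff {m n : ℕ} {γ : AromaticGraph (Fin m)} {δ : AromaticGraph (Fin n)} :
    mk γ = mk δ ↔ ∃ e : Fin m ≃ Fin n, γ.IsIso δ e := by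
  constructor
  · intro h
    obtain rfl : m = n := congrArg Sigma.fst h
    exact Quotient.exact (s := aromaticSetoid m) (eq_of_heq (Sigma.mk.inj h).2)
  · rintro ⟨e, he⟩
    obtain rfl : m = n := by simpa using Fintype.card_congr e
    exact congrArg (Sigma.mk m) (Quotient.sound (s := aromaticSetoid m) ⟨e, he⟩)

theorem of_eq_of_iff {γ : AromaticGraph V} {δ : AromaticGraph W} :
    of γ = of δ ↔ ∃ e : V ≃ W, γ.IsIso δ e := by
  rw [of, of, mk_eq_mk_iff]
  constructor
  · rintro ⟨e, he⟩
    exact ⟨_, ((isIso_relabel _ γ).trans he).trans (isIso_relabel _ δ).symm⟩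
  · rintro ⟨e, he⟩
    exact ⟨_, ((isIso_relabel _ γ).symm.trans he).trans (isIso_relabel _ δ)⟩

theorem _root_.AromaticGraph.IsIso.of_eq {γ : AromaticGraph V} {δ : AromaticGraph W} {e : V ≃ W}
    (h : γ.IsIso δ e) : of γ = of δ := of_eq_of_iff.2 ⟨e, h⟩

theorem of_eq_mk {n : ℕ} (γ : AromaticGraph (Fin n)) : of γ = mk γ :=
  mk_eq_mk_iff.2 ⟨_, (isIso_relabel _ γ).symm⟩

theorem exists_of_fin (φ : AromaticForest) :
    ∃ γ : AromaticGraph (Fin φ.size), of γ = φ := by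
  obtain ⟨n, q⟩ := φ
  induction q using Quotient.inductionOn with
  | h γ => exact ⟨γ, of_eq_mk γ⟩

@[elab_as_elim]
theorem ind_of {P : AromaticForest → Prop}
    (h : ∀ (V : Type) [Finite V] (γ : AromaticGraph V), P (of γ)) (φ : AromaticForest) : P φ := by
  obtain ⟨γ, hγ⟩ := φ.exists_of_fin
  exact hγ ▸ h _ γ

theorem of_mul_of (γ : AromaticGraph V) (δ : AromaticGraph W) :
    of γ * of δ = of (γ.disjointUnion δ) := by
  have h : of γ * of δ = mk (((γ.relabel (Finite.equivFin V)).disjointUnion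
      (δ.relabel (Finite.equivFin W))).relabel finSumFinEquiv) := rfl
  rw [h, ← of_eq_mk]
  exact of_eq_of_iff.2 ⟨_, (((isIso_relabel _ γ).disjointUnion (isIso_relabel _ δ)).trans
    (isIso_relabel finSumFinEquiv _)).symm⟩

theorem of_eq_one [IsEmpty V] (γ : AromaticGraph V) : of γ = 1 := by
  have : (1 : AromaticForest) = of (Fin.elim0 : AromaticGraph (Fin 0)) := (of_eq_mk _).symm
  rw [this]
  exact of_eq_of_iff.2 ⟨Equiv.equivOfIsEmpty _ _, fun v => isEmptyElim v⟩

theorem size_of (γ : AromaticGraph V) : (of γ).size = Nat.card V := rfl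

theorem sigma_of (γ : AromaticGraph V) : (of γ).sigma = γ.autCard :=
  (isIso_relabel _ γ).autCard_eq.symm

theorem isLoopless_of (γ : AromaticGraph V) : (of γ).IsLoopless ↔ γ.Loopless :=
  ⟨(isIso_relabel _ γ).loopless, (isIso_relabel _ γ).symm.loopless⟩

theorem numRoots_of [Fintype V] [DecidableEq V] (γ : AromaticGraph V) :
    (of γ).numRoots = γ.roots.card := by
  have h := (isIso_relabel (Finite.equivFin V) γ).roots_eq
  have h' : (of γ).numRoots = (γ.relabel (Finite.equivFin V)).roots.card := rfl
  rw [h', h, Finset.card_map]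

theorem numRoots_of_eq_natCard (γ : AromaticGraph V) :
    (of γ).numRoots = Nat.card {v // γ v = none} := by
  classical
  have := Fintype.ofFinite V
  rw [numRoots_of, roots, Nat.card_eq_fintype_card, Fintype.card_subtype]

theorem elementalOp_of {𝕜 : Type} [RCLike 𝕜] {d : ℕ} {X : Type*} [NormedAddCommGroup X]
    [NormedSpace 𝕜 X] [Fintype V] [DecidableEq V] (γ : AromaticGraph V)
    (f : (Fin d → 𝕜) → (Fin d → 𝕜)) (G : (Fin d → 𝕜) → X) (y : Fin d → 𝕜) :
    (of γ).elementalOp f G y = γ.elementalOp f G y :=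
  ((isIso_relabel (Finite.equivFin V) γ).elementalOp_eq f G y).symm

instance : CommMonoid AromaticForest where
  mul_assoc φ ψ χ := by
    induction φ using ind_of with
    | h V γ =>
    induction ψ using ind_of with
    | h W δ =>
    induction χ using ind_of with
    | h U ε =>
    simp only [of_mul_of]
    refine IsIso.of_eq (e := Equiv.sumAssoc V W U) ?_
    rintro ((v | v) | v) ((w | w) | w) <;> simp [Edge, disjointUnion]
  mul_comm φ ψ := by
    induction φ using ind_of with
    | h V γ =>
    induction ψ using ind_of with
    | h W δ =>
    simp only [of_mul_of]
    refine IsIso.of_eq (e := Equiv.sumComm V W) ?_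
    rintro (v | v) (w | w) <;> simp [Edge, disjointUnion]
  one_mul φ := by
    induction φ using ind_of with
    | h V γ =>
    rw [← of_eq_one (Fin.elim0 : AromaticGraph (Fin 0)), of_mul_of]
    refine IsIso.of_eq (e := Equiv.emptySum (Fin 0) V) ?_
    rintro (v | v) (w | w)
    · exact v.elim0
    · exact v.elim0
    · exact w.elim0
    · simp [Edge, disjointUnion]
  mul_one φ := by
    induction φ using ind_of with
    | h V γ =>
    rw [← of_eq_one (Fin.elim0 : AromaticGraph (Fin 0)), of_mul_of]
    refine IsIso.of_eq (e := Equiv.sumEmpty V (Fin 0)) ?_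
    rintro (v | v) (w | w)
    · simp [Edge, disjointUnion]
    · exact w.elim0
    · exact v.elim0
    · exact w.elim0

theorem size_mul (φ ψ : AromaticForest) : (φ * ψ).size = φ.size + ψ.size := rfl

theorem numRoots_mul (φ ψ : AromaticForest) : (φ * ψ).numRoots = φ.numRoots + ψ.numRoots := by
  induction φ using ind_of with
  | h V γ =>
  induction ψ using ind_of with
  | h W δ =>
  classical
  have := Fintype.ofFinite V
  have := Fintype.ofFinite W
  rw [of_mul_of, numRoots_of, numRoots_of, numRoots_of, roots_disjointUnion, Finset.card_disjSum]

theorem numRoots_one : (1 : AromaticForest).numRoots = 0 := by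
  rw [← of_eq_one (Fin.elim0 : AromaticGraph (Fin 0)), numRoots_of]
  rfl

theorem numRoots_le_size (φ : AromaticForest) : φ.numRoots ≤ φ.size := by
  induction φ using ind_of with
  | h V γ =>
  rw [numRoots_of_eq_natCard, size_of]
  exact Nat.card_le_card_of_injective _ Subtype.val_injective

theorem eq_one_of_size_eq_zero {φ : AromaticForest} (h : φ.size = 0) : φ = 1 := by
  induction φ using ind_of with
  | h V γ =>
  have : IsEmpty V := by
    rw [size_of] at h
    exact Finite.card_eq_zero_iff.1 h
  exact of_eq_one γ

theorem sigma_pos (φ : AromaticForest) : 0 < φ.sigma := by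
  induction φ using ind_of with
  | h V γ =>
  rw [sigma_of, autCard]
  have : Nonempty {e : Equiv.Perm V // γ.IsIso γ e} := ⟨⟨_, γ.isIso_refl⟩⟩
  exact Nat.card_pos

theorem sigma_one : (1 : AromaticForest).sigma = 1 := by
  rw [← of_eq_one (Fin.elim0 : AromaticGraph (Fin 0)), sigma_of, autCard]
  have : Unique {e : Equiv.Perm (Fin 0) // IsIso (Fin.elim0 : AromaticGraph (Fin 0)) Fin.elim0 e} :=
    ⟨⟨⟨1, fun v => v.elim0⟩⟩, fun e => Subsingleton.elim _ _⟩
  exact Nat.card_unique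

theorem mem_ofSize {φ : AromaticForest} {n : ℕ} : φ ∈ ofSize n ↔ φ.size = n := by
  simp only [ofSize, Finset.mem_map, Finset.mem_univ, true_and]
  constructor
  · rintro ⟨q, rfl⟩
    rfl
  · rintro rfl
    exact ⟨φ.2, rfl⟩

theorem of_restrict_mul_compl {γ : AromaticGraph V} {S : Set V} (h : γ.IsClopen S) :
    of (γ.restrict S) * of (γ.restrict Sᶜ) = of γ := by
  classical
  rw [of_mul_of]
  exact h.isIso_sumCompl.of_eq

theorem of_restrict_eq {γ : AromaticGraph V} {δ : AromaticGraph W} {S : Set V} (g : W → V)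
    (hg : Function.Injective g) (he : ∀ v w, γ.Edge (g v) (g w) ↔ δ.Edge v w)
    (hS : ∀ v, v ∈ S ↔ ∃ w, g w = v) : of (γ.restrict S) = of δ :=
  let ⟨e, h, _⟩ := exists_isIso_restrict g hg he hS
  (of_eq_of_iff.2 ⟨e, h⟩).symm

theorem of_restrict_union {γ : AromaticGraph V} {S T : Set V} (hS : γ.IsClopen S)
    (hST : Disjoint S T) :
    of (γ.restrict (S ∪ T)) = of (γ.restrict S) * of (γ.restrict T) := by
  rw [of_mul_of]
  refine of_restrict_eq (Sum.elim Subtype.val Subtype.val) ?_ ?_ ?_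
  · rw [Set.disjoint_left] at hST
    rintro (v | v) (w | w) h
    · simpa [Subtype.ext_iff] using h
    · exact (hST v.2 (by simp only [Sum.elim_inl, Sum.elim_inr] at h; rw [h]; exact w.2)).elim
    · exact (hST w.2 (by simp only [Sum.elim_inl, Sum.elim_inr] at h; rw [← h]; exact v.2)).elim
    · simpa [Subtype.ext_iff] using h
  · rw [Set.disjoint_left] at hST
    rintro (v | v) (w | w)
    · simp [edge_disjointUnion_inl, edge_restrict]
    · simp only [not_edge_disjointUnion_inl_inr, iff_false]
      exact fun e => hST ((hS _ _ e).1 v.2) w.2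
    · simp only [not_edge_disjointUnion_inr_inl, iff_false]
      exact fun e => hST ((hS _ _ e).2 w.2) v.2
    · simp [edge_disjointUnion_inr, edge_restrict]
  · simp

theorem of_restrict_restrict (γ : AromaticGraph V) (S : Set V) (T : Set S) :
    of ((γ.restrict S).restrict T) = of (γ.restrict (Subtype.val '' T)) := by
  symm
  refine of_restrict_eq (fun v => v.1.1) ?_ ?_ ?_
  · exact Subtype.val_injective.comp Subtype.val_injective
  · simp [edge_restrict]
  · simp

end AromaticForest

namespace AromaticForest

open AromaticGraph

variable {V W : Type} [Finite V] [Finite W]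

/-- The pairs of aromatic forests with the concatenation `φ`. -/
def factorizations (φ : AromaticForest) : Finset (AromaticForest × AromaticForest) := by
  classical exact
    ((Finset.HasAntidiagonal.antidiagonal φ.size).biUnion fun mn =>
      ofSize mn.1 ×ˢ ofSize mn.2).filter fun p => p.1 * p.2 = φ

theorem mem_factorizations {φ : AromaticForest} {p : AromaticForest × AromaticForest} :
    p ∈ φ.factorizations ↔ p.1 * p.2 = φ := by
  simp only [factorizations, Finset.mem_filter, Finset.mem_biUnion, Finset.mem_product,
    Finset.HasAntidiagonal.mem_antidiagonal, and_iff_right_iff_imp, mem_ofSize]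
  intro h
  exact ⟨(p.1.size, p.2.size), by rw [← h, size_mul], rfl, rfl⟩

theorem card_isIso {γ : AromaticGraph V} {δ : AromaticGraph W} (h : of δ = of γ) :
    Nat.card {e : W ≃ V // δ.IsIso γ e} = (of δ).sigma := by
  obtain ⟨e₀, h₀⟩ := of_eq_of_iff.1 h
  rw [sigma_of]
  exact Nat.card_congr
    { toFun := fun e => ⟨e.1.trans e₀.symm, e.2.trans h₀.symm⟩
      invFun := fun e => ⟨e.1.trans e₀, e.2.trans h₀⟩
      left_inv := fun e => by ext; simp
      right_inv := fun e => by ext; simp }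

/-- The number of ways to split the graph `γ` into two parts of given isomorphism classes. -/
theorem card_splittings {γ : AromaticGraph V} {φ ψ : AromaticForest} (h : φ * ψ = of γ) :
    Nat.card {S : Set V // γ.IsClopen S ∧ of (γ.restrict S) = φ ∧ of (γ.restrict Sᶜ) = ψ} *
      (φ.sigma * ψ.sigma) = (of γ).sigma := by
  classical
  induction φ using ind_of with
  | h V₁ δ₁ =>
  induction ψ using ind_of with
  | h V₂ δ₂ =>
  set A := {S : Set V // γ.IsClopen S ∧ of (γ.restrict S) = of δ₁ ∧ of (γ.restrict Sᶜ) = of δ₂}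
  have := Fintype.ofFinite A
  let B : A → Type := fun S => {e : V₁ ≃ S.1 // δ₁.IsIso (γ.restrict S.1) e} ×
    {e : V₂ ≃ (S.1ᶜ : Set V) // δ₂.IsIso (γ.restrict S.1ᶜ) e}
  let Φ : (Σ S : A, B S) → {e : V₁ ⊕ V₂ ≃ V // (δ₁.disjointUnion δ₂).IsIso γ e} := fun x =>
    ⟨(Equiv.sumCongr x.2.1.1 x.2.2.1).trans (Equiv.Set.sumCompl x.1.1),
      (x.2.1.2.disjointUnion x.2.2.2).trans x.1.2.1.isIso_sumCompl⟩
  have hl : ∀ x v, (Φ x).1 (.inl v) = x.2.1.1 v := fun x v => by simp [Φ]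
  have hr : ∀ x v, (Φ x).1 (.inr v) = x.2.2.1 v := fun x v => by simp [Φ]
  have hΦ : Function.Bijective Φ := by
    constructor
    · intro x x' hx
      have hS : x.1 = x'.1 := by
        apply Subtype.ext
        ext v
        have key : ∀ x : Σ S : A, B S, v ∈ x.1.1 ↔ ∃ w, (Φ x).1 (.inl w) = v := fun x => by
          simp only [hl]
          refine ⟨fun hv => ⟨x.2.1.1.symm ⟨v, hv⟩, by simp⟩, ?_⟩
          rintro ⟨w, rfl⟩
          exact (x.2.1.1 w).2
        rw [key, key, hx]
      obtain ⟨S, e₁, e₂⟩ := x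
      obtain ⟨S', e₁', e₂'⟩ := x'
      obtain rfl : S = S' := hS
      congr 2
      · ext v
        rw [← hl ⟨S, e₁, e₂⟩, hx, hl]
      · ext v
        rw [← hr ⟨S, e₁, e₂⟩, hx, hr]
    · rintro ⟨e, he⟩
      set S : Set V := Set.range fun v => e (.inl v) with hS
      obtain ⟨e₁, h₁, h₁'⟩ := exists_isIso_restrict (γ := γ) (δ := δ₁) (S := S)
        (fun v => e (.inl v)) (e.injective.comp Sum.inl_injective)
        (fun v w => (he _ _).trans edge_disjointUnion_inl) (fun v => Iff.rfl)
      obtain ⟨e₂, h₂, h₂'⟩ := exists_isIso_restrict (γ := γ) (δ := δ₂) (S := Sᶜ)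
        (fun v => e (.inr v)) (e.injective.comp Sum.inr_injective)
        (fun v w => (he _ _).trans edge_disjointUnion_inr) (fun v => by
          obtain ⟨w | w, rfl⟩ := e.surjective v <;> simp [hS])
      have hclopen : γ.IsClopen S := by
        intro v w hvw
        obtain ⟨v | v, rfl⟩ := e.surjective v <;> obtain ⟨w | w, rfl⟩ := e.surjective w
        · simp [hS]
        · exact (not_edge_disjointUnion_inl_inr ((he _ _).1 hvw)).elim
        · exact (not_edge_disjointUnion_inr_inl ((he _ _).1 hvw)).elim
        · simp [hS]
      refine ⟨⟨⟨S, hclopen, h₁.of_eq.symm, h₂.of_eq.symm⟩, ⟨e₁, h₁⟩, ⟨e₂, h₂⟩⟩, ?_⟩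
      apply Subtype.ext
      ext (v | v)
      · rw [hl, h₁']
      · rw [hr, h₂']
  have hcard : Nat.card {e : V₁ ⊕ V₂ ≃ V // (δ₁.disjointUnion δ₂).IsIso γ e} = (of γ).sigma := by
    rw [card_isIso (by rw [← h, of_mul_of]), ← of_mul_of, h]
  rw [← hcard, ← Nat.card_congr (Equiv.ofBijective Φ hΦ), Nat.card_sigma]
  have hB : ∀ S : A, Nat.card (B S) = (of δ₁).sigma * (of δ₂).sigma := fun S => by
    rw [Nat.card_prod, card_isIso S.2.2.1.symm, card_isIso S.2.2.2.symm]
  simp [hB]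

/-- Sums over the splittings of a labelled graph are sums over the factorizations of its
isomorphism class. -/
theorem sum_isClopen [Fintype (Set V)] {𝕜 : Type*} [Field 𝕜] [CharZero 𝕜] (γ : AromaticGraph V)
    [DecidablePred γ.IsClopen] (F : AromaticForest → AromaticForest → 𝕜) :
    ∑ S : Set V with γ.IsClopen S, F (of (γ.restrict S)) (of (γ.restrict Sᶜ)) =
      (of γ).sigma * ∑ p ∈ (of γ).factorizations,
        F p.1 p.2 / ((p.1.sigma : 𝕜) * (p.2.sigma : 𝕜)) := by
  classical
  rw [← Finset.sum_fiberwise_of_maps_to (t := (of γ).factorizations)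
    (g := fun S => (of (γ.restrict S), of (γ.restrict Sᶜ))), Finset.mul_sum]
  · refine Finset.sum_congr rfl fun p hp => ?_
    rw [Finset.sum_congr rfl (g := fun _ => F p.1 p.2), Finset.sum_const, nsmul_eq_mul]
    · rw [← card_splittings (mem_factorizations.1 hp), Nat.card_eq_fintype_card,
        Fintype.card_subtype, Finset.filter_filter]
      have h₁ : (p.1.sigma : 𝕜) ≠ 0 := Nat.cast_ne_zero.2 p.1.sigma_pos.ne'
      have h₂ : (p.2.sigma : 𝕜) ≠ 0 := Nat.cast_ne_zero.2 p.2.sigma_pos.ne'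
      simp only [Prod.ext_iff]
      push_cast
      field_simp
    · intro S hS
      rw [← (Finset.mem_filter.1 hS).2]
  · intro S hS
    exact mem_factorizations.2 (of_restrict_mul_compl (Finset.mem_filter.1 hS).2)

end AromaticForest

namespace RootlessForest

instance : One RootlessForest := ⟨⟨1, AromaticForest.numRoots_one⟩⟩

instance : Mul RootlessForest :=
  ⟨fun γ δ => ⟨γ.1 * δ.1, by rw [AromaticForest.numRoots_mul, γ.2, δ.2]⟩⟩

instance : CommMonoid RootlessForest where
  mul_assoc _ _ _ := Subtype.ext (mul_assoc _ _ _)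
  mul_comm _ _ := Subtype.ext (mul_comm _ _)
  one_mul _ := Subtype.ext (one_mul _)
  mul_one _ := Subtype.ext (mul_one _)

@[simp]
theorem coe_mul (γ δ : RootlessForest) : (γ * δ).1 = γ.1 * δ.1 := rfl

@[simp]
theorem coe_one : (1 : RootlessForest).1 = 1 := rfl

end RootlessForest

theorem mem_rootlessFactorizations_iff {γ : RootlessForest} {p : RootlessForest × RootlessForest} :
    p ∈ rootlessFactorizations γ ↔ p.1 * p.2 = γ := by
  rw [mem_rootlessFactorizations, Subtype.ext_iff, RootlessForest.coe_mul]

theorem sum_rootlessFactorizations {M : Type*} [AddCommMonoid M] (γ : RootlessForest)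
    (F : AromaticForest → AromaticForest → M) :
    ∑ p ∈ rootlessFactorizations γ, F p.1.1 p.2.1 =
      ∑ p ∈ γ.1.factorizations, F p.1 p.2 := by
  refine Finset.sum_bij (fun p _ => (p.1.1, p.2.1)) ?_ ?_ ?_ fun _ _ => rfl
  · intro p hp
    exact AromaticForest.mem_factorizations.2 ((mem_rootlessFactorizations γ p).1 hp)
  · rintro ⟨p₁, p₂⟩ _ ⟨q₁, q₂⟩ _ h
    simpa [Prod.ext_iff, Subtype.ext_iff] using h
  · rintro ⟨p₁, p₂⟩ hp
    rw [AromaticForest.mem_factorizations] at hp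
    have h := γ.2
    rw [← hp, AromaticForest.numRoots_mul, Nat.add_eq_zero_iff] at h
    exact ⟨(⟨p₁, h.1⟩, ⟨p₂, h.2⟩), (mem_rootlessFactorizations γ _).2 hp, rfl⟩

/-- Formal series over the rootless forests, with formal multiplication. -/
def RootlessSeries (𝕜 : Type) : Type := RootlessForest → 𝕜

namespace RootlessSeries

variable {𝕜 : Type} [Field 𝕜]

instance : Mul (RootlessSeries 𝕜) :=
  ⟨fun s t γ => ∑ p ∈ rootlessFactorizations γ, s p.1 * t p.2⟩

open Classical in
instance : One (RootlessSeries 𝕜) := ⟨fun γ => if γ = 1 then 1 else 0⟩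

theorem mul_apply (s t : RootlessSeries 𝕜) (γ : RootlessForest) :
    (s * t) γ = ∑ p ∈ rootlessFactorizations γ, s p.1 * t p.2 := rfl

open Classical in
theorem one_apply (γ : RootlessForest) :
    (1 : RootlessSeries 𝕜) γ = if γ = 1 then 1 else 0 := rfl

protected theorem mul_comm (s t : RootlessSeries 𝕜) : s * t = t * s := by
  funext γ
  rw [mul_apply, mul_apply]
  refine Finset.sum_nbij' Prod.swap Prod.swap ?_ ?_ ?_ ?_ ?_
  · intro p hp
    rw [mem_rootlessFactorizations_iff] at hp ⊢
    rw [← hp, mul_comm]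
    rfl
  · intro p hp
    rw [mem_rootlessFactorizations_iff] at hp ⊢
    rw [← hp, mul_comm]
    rfl
  · exact fun _ _ => rfl
  · exact fun _ _ => rfl
  · exact fun _ _ => mul_comm _ _

protected theorem one_mul (s : RootlessSeries 𝕜) : 1 * s = s := by
  funext γ
  rw [mul_apply, Finset.sum_eq_single (1, γ)]
  · simp [one_apply]
  · rintro ⟨p₁, p₂⟩ hp hne
    rw [mem_rootlessFactorizations_iff] at hp
    have : p₁ ≠ 1 := by
      rintro rfl
      exact hne (by rw [← hp, one_mul])
    simp [one_apply, this]
  · intro h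
    exact (h (mem_rootlessFactorizations_iff.2 (one_mul γ))).elim

protected theorem mul_assoc (s t u : RootlessSeries 𝕜) : s * t * u = s * (t * u) := by
  funext γ
  simp only [mul_apply, Finset.sum_mul, Finset.mul_sum]
  rw [Finset.sum_sigma', Finset.sum_sigma']
  refine Finset.sum_nbij' (fun x => ⟨(x.2.1, x.2.2 * x.1.2), (x.2.2, x.1.2)⟩)
    (fun x => ⟨(x.1.1 * x.2.1, x.2.2), (x.1.1, x.2.1)⟩) ?_ ?_ ?_ ?_ ?_
  · rintro ⟨⟨p₁, p₂⟩, ⟨q₁, q₂⟩⟩ h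
    simp only [Finset.mem_sigma, mem_rootlessFactorizations_iff] at h ⊢
    exact ⟨by rw [← h.1, ← h.2, mul_assoc], trivial⟩
  · rintro ⟨⟨p₁, p₂⟩, ⟨q₁, q₂⟩⟩ h
    simp only [Finset.mem_sigma, mem_rootlessFactorizations_iff] at h ⊢
    exact ⟨by rw [← h.1, ← h.2, mul_assoc], trivial⟩
  · rintro ⟨⟨p₁, p₂⟩, ⟨q₁, q₂⟩⟩ h
    simp only [Finset.mem_sigma, mem_rootlessFactorizations_iff] at h
    obtain ⟨rfl, rfl⟩ := h
    rfl
  · rintro ⟨⟨p₁, p₂⟩, ⟨q₁, q₂⟩⟩ h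
    simp only [Finset.mem_sigma, mem_rootlessFactorizations_iff] at h
    obtain ⟨rfl, rfl⟩ := h
    rfl
  · intro _ _
    exact mul_assoc _ _ _

instance : CommMonoid (RootlessSeries 𝕜) where
  mul_assoc := RootlessSeries.mul_assoc
  mul_comm := RootlessSeries.mul_comm
  one_mul := RootlessSeries.one_mul
  mul_one s := by rw [RootlessSeries.mul_comm, RootlessSeries.one_mul]

end RootlessSeries

namespace RootlessDual

variable {𝕜 : Type} [Field 𝕜]

theorem ext_coeff {a b : RootlessDual 𝕜} (h : ∀ γ, a.coeff γ = b.coeff γ) : a = b :=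
  Finsupp.lhom_ext' fun γ => LinearMap.ext_ring (h γ)

theorem coeff_mul (a b : RootlessDual 𝕜) (γ : RootlessForest) :
    (a.mul b).coeff γ = (γ.1.sigma : 𝕜) * ∑ p ∈ rootlessFactorizations γ,
      (a.coeff p.1 / (p.1.1.sigma : 𝕜)) * (b.coeff p.2 / (p.2.1.sigma : 𝕜)) := by
  simp [coeff, mul]

open Classical in
theorem coeff_one (γ : RootlessForest) :
    (one : RootlessDual 𝕜).coeff γ = if γ.1 = 1 then 1 else 0 := by
  simp [coeff, one]

theorem coeff_add (a b : RootlessDual 𝕜) (γ : RootlessForest) :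
    (a + b).coeff γ = a.coeff γ + b.coeff γ := rfl

theorem coeff_smul (c : 𝕜) (a : RootlessDual 𝕜) (γ : RootlessForest) :
    (c • a).coeff γ = c * a.coeff γ := rfl

variable (𝕜) in
/-- The product of the dual as a bilinear map. -/
def mulBilin : RootlessDual 𝕜 →ₗ[𝕜] RootlessDual 𝕜 →ₗ[𝕜] RootlessDual 𝕜 :=
  LinearMap.mk₂ 𝕜 mul
    (fun a b c => ext_coeff fun γ => by
      simp only [coeff_mul, coeff_add, add_div, add_mul, Finset.sum_add_distrib, mul_add])
    (fun r a b => ext_coeff fun γ => by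
      simp only [coeff_mul, coeff_smul, Finset.mul_sum]
      exact Finset.sum_congr rfl fun _ _ => by ring)
    (fun a b c => ext_coeff fun γ => by
      simp only [coeff_mul, coeff_add, add_div, mul_add, Finset.sum_add_distrib])
    (fun r a b => ext_coeff fun γ => by
      simp only [coeff_mul, coeff_smul, Finset.mul_sum]
      exact Finset.sum_congr rfl fun _ _ => by ring)

/-- The linear form whose normalized values are the coefficients of the series `s`. -/
def ofSeries (s : RootlessSeries 𝕜) : RootlessDual 𝕜 :=
  Finsupp.linearCombination 𝕜 fun γ : RootlessForest => (γ.1.sigma : 𝕜) * s γ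

theorem coeff_ofSeries (s : RootlessSeries 𝕜) (γ : RootlessForest) :
    (ofSeries s).coeff γ = γ.1.sigma * s γ := by
  simp [coeff, ofSeries]

theorem ofSeries_one : ofSeries (1 : RootlessSeries 𝕜) = one := by
  refine ext_coeff fun γ => ?_
  rw [coeff_ofSeries, coeff_one, RootlessSeries.one_apply]
  by_cases h : γ = 1
  · subst h
    simp [AromaticForest.sigma_one]
  · have : γ.1 ≠ 1 := fun h' => h (Subtype.ext h')
    simp [h, this]

theorem ofSeries_mul [CharZero 𝕜] (s t : RootlessSeries 𝕜) :
    ofSeries (s * t) = (ofSeries s).mul (ofSeries t) := by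
  refine ext_coeff fun γ => ?_
  rw [coeff_ofSeries, coeff_mul, RootlessSeries.mul_apply]
  congr 1
  refine Finset.sum_congr rfl fun p _ => ?_
  have h₁ : (p.1.1.sigma : 𝕜) ≠ 0 := Nat.cast_ne_zero.2 p.1.1.sigma_pos.ne'
  have h₂ : (p.2.1.sigma : 𝕜) ≠ 0 := Nat.cast_ne_zero.2 p.2.1.sigma_pos.ne'
  rw [coeff_ofSeries, coeff_ofSeries, mul_div_cancel_left₀ _ h₁, mul_div_cancel_left₀ _ h₂]

end RootlessDual

section InducedMap

variable {𝕜 : Type} [Field 𝕜]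

theorem coeff_inducedMap_single (b : AromaticForest → 𝕜) (φ : LooplessForest)
    (γ : RootlessForest) :
    (inducedMap b (MonoidAlgebra.single φ 1)).coeff γ = b (γ.1 * φ.1) := by
  simp [inducedMap, RootlessDual.coeff]

/-- The induced map is an algebra morphism as soon as it is multiplicative on forests. -/
theorem isAlgebraMorphism_inducedMap {b : AromaticForest → 𝕜}
    (h1 : inducedMap b (MonoidAlgebra.single 1 1) = RootlessDual.one)
    (hmul : ∀ φ ψ : LooplessForest, inducedMap b (MonoidAlgebra.single (φ * ψ) 1) =
      (inducedMap b (MonoidAlgebra.single φ 1)).mul (inducedMap b (MonoidAlgebra.single ψ 1))) :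
    IsAlgebraMorphism (inducedMap b) where
  map_one := h1
  map_mul x y := by
    have hsmul : ∀ (φ : LooplessForest) (r : 𝕜),
        (MonoidAlgebra.single φ r : ForestAlgebra 𝕜) = r • MonoidAlgebra.single φ 1 :=
      fun φ r => by rw [MonoidAlgebra.smul_single, smul_eq_mul, mul_one]
    change inducedMap b (x * y) = RootlessDual.mulBilin 𝕜 (inducedMap b x) (inducedMap b y)
    induction x using MonoidAlgebra.induction_linear with
    | zero => simp
    | add x₁ x₂ h₁ h₂ => simp [add_mul, h₁, h₂]
    | single φ r =>
      induction y using MonoidAlgebra.induction_linear with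
      | zero => simp
      | add y₁ y₂ h₁ h₂ => simp only [mul_add, h₁, h₂, map_add]
      | single ψ s =>
        rw [MonoidAlgebra.single_mul_single, hsmul φ, hsmul ψ, hsmul (φ * ψ), map_smul, map_smul,
          map_smul, hmul, map_smul, map_smul, LinearMap.smul_apply, smul_smul, mul_comm r s]
        rfl

end InducedMap

namespace AromaticGraph

open AromaticForest

variable {V W : Type}

/-- The nodes from which there is a directed path to `r`. -/
def flow (γ : AromaticGraph V) (r : V) : Set V := {v | Relation.ReflTransGen γ.Edge v r}

/-- The nodes from which there is no directed path to a root. -/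
def core (γ : AromaticGraph V) : Set V := {v | ∀ r, γ r = none → v ∉ γ.flow r}

theorem Edge.eq {γ : AromaticGraph V} {v w w' : V} (h : γ.Edge v w) (h' : γ.Edge v w') : w = w' :=
  Option.some_injective _ (h.symm.trans h')

theorem self_mem_flow (γ : AromaticGraph V) (r : V) : r ∈ γ.flow r := .refl

theorem isClopen_flow {γ : AromaticGraph V} {r : V} (hr : γ r = none) :
    γ.IsClopen (γ.flow r) := by
  intro v w hvw
  refine ⟨fun h => ?_, fun h => Relation.ReflTransGen.head hvw h⟩
  rcases Relation.ReflTransGen.cases_head h with rfl | ⟨w', hw', h'⟩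
  · rw [Edge, hr] at hvw
    cases hvw
  · rwa [hvw.eq hw']

theorem eq_of_mem_flow {γ : AromaticGraph V} {r r' v : V} (hr : γ r = none) (hr' : γ r' = none)
    (h : v ∈ γ.flow r) (h' : v ∈ γ.flow r') : r = r' := by
  induction h using Relation.ReflTransGen.head_induction_on with
  | refl =>
    rcases Relation.ReflTransGen.cases_head h' with rfl | ⟨w, hw, _⟩
    · rfl
    · rw [Edge, hr] at hw
      cases hw
  | head hvw _ ih => exact ih ((isClopen_flow hr' _ _ hvw).1 h')

theorem isClopen_core (γ : AromaticGraph V) : γ.IsClopen γ.core := by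
  intro v w hvw
  exact forall_congr' fun r => forall_congr' fun hr => not_congr (isClopen_flow hr v w hvw)

theorem ne_none_of_mem_core {γ : AromaticGraph V} {v : V} (hv : v ∈ γ.core) : γ v ≠ none :=
  fun h => hv v h (γ.self_mem_flow v)

theorem IsIso.mem_flow_iff {γ : AromaticGraph V} {δ : AromaticGraph W} {e : V ≃ W}
    (h : γ.IsIso δ e) (v r : V) : e v ∈ δ.flow (e r) ↔ v ∈ γ.flow r := by
  refine ⟨fun hv => ?_, fun hv => hv.lift e fun a b hab => (h a b).2 hab⟩
  have hv' : Relation.ReflTransGen δ.Edge (e v) (e r) := hv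
  simpa [flow, Function.onFun] using hv'.lift e.symm fun a b hab => (h.symm a b).2 hab

theorem IsIso.eq_none_iff {γ : AromaticGraph V} {δ : AromaticGraph W} {e : V ≃ W}
    (h : γ.IsIso δ e) (v : V) : δ (e v) = none ↔ γ v = none := by
  rw [isIso_iff_map.1 h, Option.map_eq_none_iff]

theorem IsIso.mem_core_iff {γ : AromaticGraph V} {δ : AromaticGraph W} {e : V ≃ W}
    (h : γ.IsIso δ e) (v : V) : e v ∈ δ.core ↔ v ∈ γ.core := by
  simp only [core, Set.mem_ofPred_eq]
  rw [← e.forall_congr_right]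
  simp [h.mem_flow_iff, h.eq_none_iff]

theorem mem_flow_disjointUnion_inl {γ : AromaticGraph V} {δ : AromaticGraph W} {x : V ⊕ W}
    {r : V} : x ∈ (γ.disjointUnion δ).flow (.inl r) ↔ ∃ v ∈ γ.flow r, .inl v = x := by
  constructor
  · intro h
    induction h using Relation.ReflTransGen.head_induction_on with
    | refl => exact ⟨r, .refl, rfl⟩
    | @head x y hxy _ ih =>
      obtain ⟨v, hv, rfl⟩ := ih
      rcases x with x | x
      · exact ⟨x, .head (edge_disjointUnion_inl.1 hxy) hv, rfl⟩
      · exact (not_edge_disjointUnion_inr_inl hxy).elim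
  · rintro ⟨v, hv, rfl⟩
    have hv' : Relation.ReflTransGen _ v r := hv
    exact hv'.lift Sum.inl fun a b hab => edge_disjointUnion_inl.2 hab

theorem mem_flow_disjointUnion_inr {γ : AromaticGraph V} {δ : AromaticGraph W} {x : V ⊕ W}
    {r : W} : x ∈ (γ.disjointUnion δ).flow (.inr r) ↔ ∃ v ∈ δ.flow r, .inr v = x := by
  constructor
  · intro h
    induction h using Relation.ReflTransGen.head_induction_on with
    | refl => exact ⟨r, .refl, rfl⟩
    | @head x y hxy _ ih =>
      obtain ⟨v, hv, rfl⟩ := ih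
      rcases x with x | x
      · exact (not_edge_disjointUnion_inl_inr hxy).elim
      · exact ⟨x, .head (edge_disjointUnion_inr.1 hxy) hv, rfl⟩
  · rintro ⟨v, hv, rfl⟩
    have hv' : Relation.ReflTransGen _ v r := hv
    exact hv'.lift Sum.inr fun a b hab => edge_disjointUnion_inr.2 hab

/-- In a finite graph without directed cycles, every node is connected to a root. -/
theorem Loopless.core_eq_empty [Finite V] {γ : AromaticGraph V} (h : γ.Loopless) :
    γ.core = ∅ := by
  have : IsTrans V fun v w => Relation.TransGen γ.Edge w v := ⟨fun _ _ _ h h' => h'.trans h⟩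
  have : Std.Irrefl fun v w => Relation.TransGen γ.Edge w v := ⟨h⟩
  have wf := Finite.wellFounded_of_trans_of_irrefl fun v w => Relation.TransGen γ.Edge w v
  rw [Set.eq_empty_iff_forall_notMem]
  intro v
  induction v using wf.induction with
  | h v ih =>
    intro hv
    cases hw : γ v with
    | none => exact ne_none_of_mem_core hv hw
    | some w => exact ih w (.single hw) ((γ.isClopen_core v w hw).1 hv)

theorem loopless_restrict_compl_core (γ : AromaticGraph V) : (γ.restrict γ.coreᶜ).Loopless := by
  rintro ⟨v, hv⟩ hloop
  have hloop' : Relation.TransGen γ.Edge v v :=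
    hloop.lift Subtype.val fun a b hab => edge_restrict.1 hab
  clear hloop
  simp only [core, Set.mem_compl_iff, Set.mem_ofPred_eq, not_forall, not_not] at hv
  obtain ⟨r, hr, hvr⟩ := hv
  induction hvr using Relation.ReflTransGen.head_induction_on with
  | refl =>
    obtain ⟨w, hw, _⟩ := Relation.TransGen.head'_iff.1 hloop'
    rw [Edge, hr] at hw
    cases hw
  | head hvw _ ih =>
    obtain ⟨w', hw', h'⟩ := Relation.TransGen.head'_iff.1 hloop'
    obtain rfl := hvw.eq hw'
    exact ih (Relation.TransGen.tail' h' hw')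

/-- The trees of the roots of `γ`. -/
def treeParts [Fintype V] [DecidableEq V] (γ : AromaticGraph V) : Multiset AromaticForest :=
  γ.roots.val.map fun r => of (γ.restrict (γ.flow r))

theorem of_restrict_congr [Finite V] [Finite W] {γ : AromaticGraph V} {δ : AromaticGraph W}
    {e : V ≃ W} (h : γ.IsIso δ e) {S : Set V} {T : Set W} (hST : ∀ v, e v ∈ T ↔ v ∈ S) :
    of (δ.restrict T) = of (γ.restrict S) := by
  refine of_restrict_eq (fun v => e v) (e.injective.comp Subtype.val_injective)
    (fun v w => by rw [h v w, edge_restrict]) fun w => ?_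
  obtain ⟨v, rfl⟩ := e.surjective w
  simp [hST]

theorem IsIso.treeParts_eq [Fintype V] [DecidableEq V] [Fintype W] [DecidableEq W]
    {γ : AromaticGraph V} {δ : AromaticGraph W} {e : V ≃ W} (h : γ.IsIso δ e) :
    δ.treeParts = γ.treeParts := by
  rw [treeParts, treeParts, h.roots_eq, Finset.map_val, Multiset.map_map]
  exact Multiset.map_congr rfl fun r _ => of_restrict_congr h fun v => h.mem_flow_iff v r

theorem IsIso.of_restrict_core [Finite V] [Finite W] {γ : AromaticGraph V} {δ : AromaticGraph W}
    {e : V ≃ W} (h : γ.IsIso δ e) : of (δ.restrict δ.core) = of (γ.restrict γ.core) :=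
  of_restrict_congr h h.mem_core_iff

end AromaticGraph

namespace AromaticForest

open AromaticGraph

variable {V W : Type}

/-- The multiset of the trees of the roots of an aromatic forest. -/
def treeParts (φ : AromaticForest) : Multiset AromaticForest :=
  Quotient.lift (s := aromaticSetoid φ.1) (fun γ => γ.treeParts)
    (fun _ _ ⟨_, h⟩ => h.treeParts_eq.symm) φ.2

/-- The rootless part of an aromatic forest. -/
def aromPart (φ : AromaticForest) : AromaticForest :=
  Quotient.lift (s := aromaticSetoid φ.1) (fun γ => of (γ.restrict γ.core))
    (fun _ _ ⟨_, h⟩ => h.of_restrict_core.symm) φ.2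

theorem treeParts_of [Fintype V] [DecidableEq V] (γ : AromaticGraph V) :
    (of γ).treeParts = γ.treeParts := (isIso_relabel (Finite.equivFin V) γ).treeParts_eq

theorem aromPart_of [Finite V] (γ : AromaticGraph V) :
    (of γ).aromPart = of (γ.restrict γ.core) :=
  (isIso_relabel (Finite.equivFin V) γ).of_restrict_core

theorem treeParts_mul (φ ψ : AromaticForest) :
    (φ * ψ).treeParts = φ.treeParts + ψ.treeParts := by
  classical
  induction φ using ind_of with
  | h V γ =>
  induction ψ using ind_of with
  | h W δ =>
  have := Fintype.ofFinite V
  have := Fintype.ofFinite W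
  rw [of_mul_of, treeParts_of, treeParts_of, treeParts_of, AromaticGraph.treeParts,
    roots_disjointUnion, Finset.val_disjSum, Multiset.disjSum, Multiset.map_add,
    Multiset.map_map, Multiset.map_map]
  congr 1
  · refine Multiset.map_congr rfl fun r _ => ?_
    refine of_restrict_eq (fun v => .inl v) (Sum.inl_injective.comp Subtype.val_injective)
      (fun v w => by rw [edge_disjointUnion_inl, edge_restrict]) fun x => ?_
    rw [mem_flow_disjointUnion_inl]
    simp
  · refine Multiset.map_congr rfl fun r _ => ?_
    refine of_restrict_eq (fun v => .inr v) (Sum.inr_injective.comp Subtype.val_injective)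
      (fun v w => by rw [edge_disjointUnion_inr, edge_restrict]) fun x => ?_
    rw [mem_flow_disjointUnion_inr]
    simp

theorem aromPart_mul (φ ψ : AromaticForest) :
    (φ * ψ).aromPart = φ.aromPart * ψ.aromPart := by
  induction φ using ind_of with
  | h V γ =>
  induction ψ using ind_of with
  | h W δ =>
  rw [of_mul_of, aromPart_of, aromPart_of, aromPart_of, of_mul_of]
  refine of_restrict_eq (Sum.map Subtype.val Subtype.val)
    (Sum.map_injective.2 ⟨Subtype.val_injective, Subtype.val_injective⟩) ?_ ?_
  · rintro (v | v) (w | w)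
    · simp [edge_disjointUnion_inl, edge_restrict]
    · simp [not_edge_disjointUnion_inl_inr]
    · simp [not_edge_disjointUnion_inr_inl]
    · simp [edge_disjointUnion_inr, edge_restrict]
  · have hl : ∀ v, (γ.disjointUnion δ) (.inl v) = none ↔ γ v = none := by simp [disjointUnion]
    have hr : ∀ w, (γ.disjointUnion δ) (.inr w) = none ↔ δ w = none := by simp [disjointUnion]
    rintro (v | v) <;>
      simp [core, hl, hr, mem_flow_disjointUnion_inl, mem_flow_disjointUnion_inr] <;>
      exact forall₂_congr fun r _ =>
        ⟨fun h hv => h v hv rfl, fun h x hx hxv => h (hxv ▸ hx)⟩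

theorem numRoots_aromPart (φ : AromaticForest) : φ.aromPart.numRoots = 0 := by
  induction φ using ind_of with
  | h V γ =>
  rw [aromPart_of, numRoots_of_eq_natCard, Finite.card_eq_zero_iff]
  exact ⟨fun v => ne_none_of_mem_core v.1.2 ((γ.isClopen_core.restrict_eq_none _).1 v.2)⟩

theorem treeParts_eq_zero {φ : AromaticForest} (h : φ.numRoots = 0) : φ.treeParts = 0 := by
  classical
  induction φ using ind_of with
  | h V γ =>
  have := Fintype.ofFinite V
  rw [numRoots_of, Finset.card_eq_zero] at h
  rw [treeParts_of, AromaticGraph.treeParts, h]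
  rfl

theorem of_restrict_univ [Finite V] (γ : AromaticGraph V) : of (γ.restrict Set.univ) = of γ :=
  of_restrict_eq id Function.injective_id (fun _ _ => Iff.rfl) (by simp)

theorem of_restrict_empty [Finite V] (γ : AromaticGraph V) : of (γ.restrict ∅) = 1 :=
  of_eq_one _

theorem aromPart_eq_self {φ : AromaticForest} (h : φ.numRoots = 0) : φ.aromPart = φ := by
  induction φ using ind_of with
  | h V γ =>
  rw [numRoots_of_eq_natCard, Finite.card_eq_zero_iff] at h
  have hcore : γ.core = Set.univ := by
    ext v
    simp only [core, Set.mem_ofPred_eq, Set.mem_univ, iff_true]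
    exact fun r hr => (h.false ⟨r, hr⟩).elim
  rw [aromPart_of, hcore, of_restrict_univ]

theorem IsLoopless.aromPart_eq_one {φ : AromaticForest} (h : φ.IsLoopless) : φ.aromPart = 1 := by
  induction φ using ind_of with
  | h V γ =>
  rw [isLoopless_of] at h
  rw [aromPart_of, h.core_eq_empty, of_restrict_empty]

theorem exists_treeParts_eq_singleton {φ : AromaticForest} (h : φ.numRoots = 1) :
    ∃ τ : AromaticForest, φ.treeParts = {τ} ∧ φ = φ.aromPart * τ := by
  classical
  induction φ using ind_of with
  | h V γ =>
  have := Fintype.ofFinite V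
  rw [numRoots_of, Finset.card_eq_one] at h
  obtain ⟨r, hr⟩ := h
  have hroot : ∀ v, γ v = none ↔ v = r := fun v => by
    rw [← Finset.mem_singleton (a := r), ← hr]
    simp [roots]
  refine ⟨of (γ.restrict (γ.flow r)), ?_, ?_⟩
  · rw [treeParts_of, AromaticGraph.treeParts, hr]
    rfl
  · have hcore : γ.flow r = γ.coreᶜ := by
      ext v
      simp [core, hroot]
    rw [aromPart_of, hcore, of_restrict_mul_compl γ.isClopen_core]

end AromaticForest

section Extension

variable {𝕜 : Type} [Field 𝕜]

open Classical in
/-- The extension by zero of a function on the aromatic trees. -/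
def treeExtension (a : AromaticTree → 𝕜) (φ : AromaticForest) : 𝕜 :=
  if h : φ.numRoots = 1 then a ⟨φ, h⟩ else 0

theorem treeExtension_tree (a : AromaticTree → 𝕜) (τ : AromaticTree) :
    treeExtension a τ.1 = a τ := by
  rw [treeExtension, dif_pos τ.2]

/-- The normalized series `∑ γ, a(γ τ) / σ(γ) γ`. -/
def treeSeries (a : AromaticTree → 𝕜) (τ : AromaticForest) : RootlessSeries 𝕜 :=
  fun γ => treeExtension a (γ.1 * τ) / (γ.1.sigma : 𝕜)

/-- The multiplicative extension of a function on the aromatic trees. -/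
def multiplicativeExtension (a : AromaticTree → 𝕜) (φ : AromaticForest) : 𝕜 :=
  φ.aromPart.sigma * ((φ.treeParts.map (treeSeries a)).prod : RootlessSeries 𝕜)
    ⟨φ.aromPart, φ.numRoots_aromPart⟩

theorem inducedMap_multiplicativeExtension_single (a : AromaticTree → 𝕜) (φ : LooplessForest) :
    inducedMap (multiplicativeExtension a) (MonoidAlgebra.single φ 1) =
      RootlessDual.ofSeries (φ.1.treeParts.map (treeSeries a)).prod := by
  refine RootlessDual.ext_coeff fun γ => ?_
  rw [coeff_inducedMap_single, RootlessDual.coeff_ofSeries, multiplicativeExtension]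
  have h₁ : (γ.1 * φ.1).aromPart = γ.1 := by
    rw [AromaticForest.aromPart_mul, φ.2.aromPart_eq_one, mul_one,
      AromaticForest.aromPart_eq_self γ.2]
  have h₂ : (γ.1 * φ.1).treeParts = φ.1.treeParts := by
    rw [AromaticForest.treeParts_mul, AromaticForest.treeParts_eq_zero γ.2, zero_add]
  simp only [h₁, h₂]

theorem isMultiplicativeExtension_multiplicativeExtension [CharZero 𝕜] (a : AromaticTree → 𝕜) :
    IsMultiplicativeExtension a (multiplicativeExtension a) where
  eq_on_trees τ := by
    obtain ⟨ψ, h₁, h₂⟩ := AromaticForest.exists_treeParts_eq_singleton τ.2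
    have h : (τ.1.aromPart.sigma : 𝕜) ≠ 0 := Nat.cast_ne_zero.2 (AromaticForest.sigma_pos _).ne'
    rw [multiplicativeExtension, h₁, Multiset.map_singleton, Multiset.prod_singleton, treeSeries,
      ← h₂, treeExtension_tree, mul_div_cancel₀ _ h]
  isAlgebraMorphism := by
    refine isAlgebraMorphism_inducedMap ?_ fun φ ψ => ?_
    · rw [inducedMap_multiplicativeExtension_single]
      change RootlessDual.ofSeries
        ((1 : AromaticForest).treeParts.map (treeSeries a)).prod = _
      rw [AromaticForest.treeParts_eq_zero AromaticForest.numRoots_one, Multiset.map_zero,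
        Multiset.prod_zero, RootlessDual.ofSeries_one]
    · simp only [inducedMap_multiplicativeExtension_single]
      change RootlessDual.ofSeries ((φ.1 * ψ.1).treeParts.map (treeSeries a)).prod = _
      rw [AromaticForest.treeParts_mul, Multiset.map_add, Multiset.prod_add,
        RootlessDual.ofSeries_mul]

end Extension

namespace AromaticGraph

open AromaticForest

variable {V : Type}

theorem Loopless.restrict_mono {γ : AromaticGraph V} {S T : Set V} (hST : S ⊆ T)
    (h : (γ.restrict T).Loopless) : (γ.restrict S).Loopless := fun v hv =>
  h (Set.inclusion hST v) (Relation.TransGen.lift (r := (γ.restrict S).Edge)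
    (p := (γ.restrict T).Edge) (Set.inclusion hST) (fun _ _ hab =>
      edge_restrict.2 ((edge_restrict (S := S)).1 hab)) _ _ hv)

theorem IsClopen.image_val {γ : AromaticGraph V} {S : Set V} (hS : γ.IsClopen S) {T : Set S}
    (hT : (γ.restrict S).IsClopen T) : γ.IsClopen (Subtype.val '' T) := by
  intro v w hvw
  constructor
  · rintro ⟨x, hx, rfl⟩
    have hw : w ∈ S := (hS _ _ hvw).1 x.2
    exact ⟨⟨w, hw⟩, (hT x ⟨w, hw⟩ (edge_restrict.2 hvw)).1 hx, rfl⟩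
  · rintro ⟨x, hx, rfl⟩
    have hv : v ∈ S := (hS _ _ hvw).2 x.2
    exact ⟨⟨v, hv⟩, (hT ⟨v, hv⟩ x (edge_restrict.2 hvw)).2 hx, rfl⟩

theorem IsClopen.preimage_val {γ : AromaticGraph V} {S T : Set V} (hT : γ.IsClopen T) :
    (γ.restrict S).IsClopen (Subtype.val ⁻¹' T) := fun _ _ hvw => hT _ _ (edge_restrict.1 hvw)

theorem IsClopen.mem_iff_of_mem_flow {γ : AromaticGraph V} {T : Set V} (hT : γ.IsClopen T)
    {v r : V} (h : v ∈ γ.flow r) : v ∈ T ↔ r ∈ T := by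
  induction h using Relation.ReflTransGen.head_induction_on with
  | refl => rfl
  | head hvw _ ih => exact (hT _ _ hvw).trans ih

theorem disjoint_core_flow {γ : AromaticGraph V} {r : V} (hr : γ r = none) :
    Disjoint γ.core (γ.flow r) := Set.disjoint_left.2 fun _ hv hv' => hv r hr hv'

/-- `r` is the only root of `γ` in `T`. -/
def IsOnlyRoot (γ : AromaticGraph V) (r : V) (T : Set V) : Prop :=
  ∀ v, γ v = none → (v ∈ T ↔ v = r)

theorem isOnlyRoot_union_flow {γ : AromaticGraph V} {r : V} (hr : γ r = none) {S : Set V}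
    (hS : S ⊆ γ.core) : γ.IsOnlyRoot r (S ∪ γ.flow r) := by
  intro v hv
  constructor
  · rintro (h | h)
    · exact (ne_none_of_mem_core (hS h) hv).elim
    · exact eq_of_mem_flow hv hr (γ.self_mem_flow v) h
  · rintro rfl
    exact Or.inr (γ.self_mem_flow v)

theorem IsOnlyRoot.inter_core_union_flow {γ : AromaticGraph V} {r : V} {T : Set V}
    (hr : γ r = none) (h : γ.IsOnlyRoot r T) (hT : γ.IsClopen T) :
    T ∩ γ.core ∪ γ.flow r = T := by
  ext v
  constructor
  · rintro (hv | hv)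
    · exact hv.1
    · exact (hT.mem_iff_of_mem_flow hv).2 ((h r hr).2 rfl)
  · intro hv
    by_cases hc : v ∈ γ.core
    · exact Or.inl ⟨hv, hc⟩
    · simp only [core, Set.mem_ofPred_eq, not_forall, not_not] at hc
      obtain ⟨r', hr', hvr'⟩ := hc
      have hr'T := (hT.mem_iff_of_mem_flow hvr').1 hv
      rw [← (h r' hr').1 hr'T]
      exact Or.inr hvr'

theorem numRoots_restrict_eq_one_iff [Finite V] {γ : AromaticGraph V} {T : Set V}
    (hT : γ.IsClopen T) :
    (of (γ.restrict T)).numRoots = 1 ↔ ∃ r, γ r = none ∧ γ.IsOnlyRoot r T := by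
  rw [numRoots_of_eq_natCard, Nat.card_eq_one_iff_unique]
  constructor
  · rintro ⟨hs, ⟨r⟩⟩
    have hr := (hT.restrict_eq_none _).1 r.2
    refine ⟨r.1.1, hr, fun v hv => ⟨fun hvT => ?_, ?_⟩⟩
    · have := hs.elim ⟨⟨v, hvT⟩, (hT.restrict_eq_none _).2 hv⟩ r
      rw [← this]
    · rintro rfl
      exact r.1.2
  · rintro ⟨r, hr, h⟩
    refine ⟨⟨fun v w => ?_⟩, ⟨⟨⟨r, (h r hr).2 rfl⟩, (hT.restrict_eq_none _).2 hr⟩⟩⟩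
    have key : ∀ v : {v // γ.restrict T v = none}, v.1.1 = r := fun v =>
      (h _ ((hT.restrict_eq_none _).1 v.2)).1 v.1.2
    exact Subtype.ext (Subtype.ext ((key v).trans (key w).symm))

end AromaticGraph

namespace IsMultiplicativeExtension

open AromaticGraph AromaticForest

variable {𝕜 : Type} [Field 𝕜] {a : AromaticTree → 𝕜} {b : AromaticForest → 𝕜}

open Classical in
theorem apply_rootless (h : IsMultiplicativeExtension a b) {φ : AromaticForest}
    (hφ : φ.numRoots = 0) : b φ = if φ = 1 then 1 else 0 := by
  have h1 := coeff_inducedMap_single b 1 ⟨φ, hφ⟩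
  rw [← MonoidAlgebra.one_def, h.isAlgebraMorphism.map_one, RootlessDual.coeff_one] at h1
  rw [h1]
  exact congrArg b (mul_one φ).symm

theorem apply_mul_mul (h : IsMultiplicativeExtension a b) {γ φ ψ : AromaticForest}
    (hγ : γ.numRoots = 0) (hφ : φ.IsLoopless) (hψ : ψ.IsLoopless) :
    b (γ * (φ * ψ)) = γ.sigma * ∑ p ∈ γ.factorizations,
      b (p.1 * φ) * b (p.2 * ψ) / ((p.1.sigma : 𝕜) * p.2.sigma) := by
  have hmul := h.isAlgebraMorphism.map_mul (MonoidAlgebra.single ⟨φ, hφ⟩ 1)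
    (MonoidAlgebra.single ⟨ψ, hψ⟩ 1)
  rw [MonoidAlgebra.single_mul_single, mul_one] at hmul
  have hcoeff := congrArg (fun c => RootlessDual.coeff c ⟨γ, hγ⟩) hmul
  simp only [RootlessDual.coeff_mul, coeff_inducedMap_single] at hcoeff
  refine hcoeff.trans ?_
  simp only [div_mul_div_comm]
  exact congrArg _ (sum_rootlessFactorizations ⟨γ, hγ⟩ fun p q =>
      b (p * φ) * b (q * ψ) / ((p.sigma : 𝕜) * q.sigma))

section Graph

variable [CharZero 𝕜] {V : Type} [Finite V]

open Classical in
theorem apply_graph_of_root [Fintype (Set V)] (h : IsMultiplicativeExtension a b)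
    (γ : AromaticGraph V) {r : V} (hr : γ r = none) :
    b (of γ) = ∑ T : Set V with γ.IsClopen T ∧ γ.IsOnlyRoot r T,
      b (of (γ.restrict T)) * b (of (γ.restrict Tᶜ)) := by
  have := Fintype.ofFinite (Set γ.core)
  have hcore := γ.isClopen_core
  have hflow := isClopen_flow hr
  have hdisj := disjoint_core_flow hr
  set R : Set V := (γ.core ∪ γ.flow r)ᶜ with hR
  have hRclopen : γ.IsClopen R := (hcore.union hflow).compl
  have hγ : of γ = of (γ.restrict γ.core) * (of (γ.restrict (γ.flow r)) * of (γ.restrict R)) := by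
    rw [← mul_assoc, ← of_restrict_union hcore hdisj, of_restrict_mul_compl (hcore.union hflow)]
  have hroots : (of (γ.restrict γ.core)).numRoots = 0 := by
    rw [← aromPart_of, numRoots_aromPart]
  have hF : (of (γ.restrict (γ.flow r))).IsLoopless :=
    (isLoopless_of _).2 (γ.loopless_restrict_compl_core.restrict_mono hdisj.subset_compl_left)
  have hRl : (of (γ.restrict R)).IsLoopless :=
    (isLoopless_of _).2 (γ.loopless_restrict_compl_core.restrict_mono
      (Set.compl_subset_compl.2 Set.subset_union_left))
  rw [hγ, h.apply_mul_mul hroots hF hRl]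
  rw [← sum_isClopen (γ.restrict γ.core) fun p q =>
    b (p * of (γ.restrict (γ.flow r))) * b (q * of (γ.restrict R))]
  refine Finset.sum_nbij' (fun S => Subtype.val '' S ∪ γ.flow r) (fun T => Subtype.val ⁻¹' T)
    ?_ ?_ ?_ ?_ ?_
  · intro S hS
    simp only [Finset.mem_filter, Finset.mem_univ, true_and] at hS ⊢
    exact ⟨(hcore.image_val hS).union hflow,
      isOnlyRoot_union_flow hr (Subtype.coe_image_subset _ _)⟩
  · intro T hT
    simp only [Finset.mem_filter, Finset.mem_univ, true_and] at hT ⊢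
    exact hT.1.preimage_val
  · intro S _
    ext v
    have hv : v.1 ∉ γ.flow r := Set.disjoint_left.1 hdisj v.2
    simp [hv]
  · intro T hT
    simp only [Finset.mem_filter, Finset.mem_univ, true_and] at hT
    change Subtype.val '' (Subtype.val ⁻¹' T) ∪ _ = T
    rw [Subtype.image_preimage_coe, Set.inter_comm, hT.2.inter_core_union_flow hr hT.1]
  · intro S hS
    simp only [Finset.mem_filter, Finset.mem_univ, true_and] at hS
    have hsub : ∀ S : Set γ.core, Subtype.val '' S ⊆ γ.core := Subtype.coe_image_subset _
    have hcompl : (Subtype.val '' S ∪ γ.flow r)ᶜ = Subtype.val '' Sᶜ ∪ R := by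
      ext v
      by_cases hv : v ∈ γ.core
      · have := Set.disjoint_left.1 hdisj hv
        simp [hR, hv, this]
      · simp [hR, hv]
    have hdisjR : Disjoint (Subtype.val '' Sᶜ) R :=
      (disjoint_compl_right.mono_left Set.subset_union_left).mono_left (hsub _)
    rw [hcompl, of_restrict_union (hcore.image_val hS) (hdisj.mono_left (hsub S)),
      of_restrict_union (hcore.image_val hS.compl) hdisjR, of_restrict_restrict,
      of_restrict_restrict]

theorem numRoots_mul_apply (h : IsMultiplicativeExtension a b) (φ : AromaticForest) :
    φ.numRoots * b φ = φ.sigma * ∑ p ∈ φ.factorizations,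
      treeExtension a p.1 * b p.2 / ((p.1.sigma : 𝕜) * p.2.sigma) := by
  classical
  induction φ using ind_of with
  | h V γ =>
  have := Fintype.ofFinite V
  rw [← sum_isClopen γ fun p q => treeExtension a p * b q]
  rw [numRoots_of, ← nsmul_eq_mul, ← Finset.sum_const]
  rw [Finset.sum_congr rfl (g := fun r => ∑ T : Set V with γ.IsClopen T ∧ γ.IsOnlyRoot r T,
      b (of (γ.restrict T)) * b (of (γ.restrict Tᶜ)))]
  · rw [Finset.sum_comm' (t' := Finset.univ.filter γ.IsClopen)
      (s' := fun T => γ.roots.filter fun r => γ.IsOnlyRoot r T)]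
    · refine Finset.sum_congr rfl fun T hT => ?_
      have hT : γ.IsClopen T := (Finset.mem_filter.1 hT).2
      by_cases h1 : (of (γ.restrict T)).numRoots = 1
      · obtain ⟨r, hr, hrT⟩ := (numRoots_restrict_eq_one_iff hT).1 h1
        have hs : γ.roots.filter (fun r => γ.IsOnlyRoot r T) = {r} := by
          ext r'
          simp only [Finset.mem_filter, roots, Finset.mem_univ, true_and, Finset.mem_singleton]
          constructor
          · rintro ⟨hr', hrT'⟩
            exact (hrT _ hr').1 ((hrT' _ hr').2 rfl)
          · rintro rfl
            exact ⟨hr, hrT⟩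
        have hb : b (of (γ.restrict T)) = treeExtension a (of (γ.restrict T)) :=
          (h.eq_on_trees ⟨_, h1⟩).trans (treeExtension_tree a ⟨_, h1⟩).symm
        rw [hs, Finset.sum_singleton, hb]
      · have hs : γ.roots.filter (fun r => γ.IsOnlyRoot r T) = ∅ := by
          refine Finset.filter_eq_empty_iff.2 fun r hr hrT => ?_
          exact h1 ((numRoots_restrict_eq_one_iff hT).2 ⟨r, (Finset.mem_filter.1 hr).2, hrT⟩)
        rw [hs, Finset.sum_empty, treeExtension, dif_neg h1, zero_mul]
    · intro r T
      simp only [Finset.mem_filter, Finset.mem_univ, true_and]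
      tauto
  · intro r hr
    exact h.apply_graph_of_root γ (Finset.mem_filter.1 hr).2

end Graph

theorem unique [CharZero 𝕜] {b' : AromaticForest → 𝕜} (h : IsMultiplicativeExtension a b)
    (h' : IsMultiplicativeExtension a b') : b = b' := by
  funext φ
  induction hk : φ.numRoots generalizing φ with
  | zero => rw [h.apply_rootless hk, h'.apply_rootless hk]
  | succ k ih =>
    have hne : (φ.numRoots : 𝕜) ≠ 0 := by
      rw [hk]
      exact Nat.cast_ne_zero.2 k.succ_ne_zero
    refine mul_left_cancel₀ hne ?_
    rw [h.numRoots_mul_apply, h'.numRoots_mul_apply]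
    congr 1
    refine Finset.sum_congr rfl fun p hp => ?_
    by_cases h1 : p.1.numRoots = 1
    · have hsum := hk
      rw [← mem_factorizations.1 hp, numRoots_mul, h1] at hsum
      rw [ih p.2 (by omega)]
    · rw [treeExtension, dif_neg h1, zero_mul, zero_mul]

end IsMultiplicativeExtension

theorem existsUnique_isMultiplicativeExtension {𝕜 : Type} [Field 𝕜] [CharZero 𝕜]
    (a : AromaticTree → 𝕜) : ∃! b : AromaticForest → 𝕜, IsMultiplicativeExtension a b :=
  ⟨multiplicativeExtension a, isMultiplicativeExtension_multiplicativeExtension a,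
    fun _ h => h.unique (isMultiplicativeExtension_multiplicativeExtension a)⟩

section Analysis

open AromaticGraph AromaticForest

universe u

variable {𝕜 : Type} [RCLike 𝕜] {d : ℕ} {X : Type u} [NormedAddCommGroup X] [NormedSpace 𝕜 X]

theorem ContDiff.fderiv_infty {E : Type*} [NormedAddCommGroup E] [NormedSpace 𝕜 E] {G : E → X}
    (hG : ContDiff 𝕜 ∞ G) : ContDiff 𝕜 ∞ (fderiv 𝕜 G) := hG.fderiv_right (by simp)

section Directional

variable {E : Type*} [NormedAddCommGroup E] [NormedSpace 𝕜 E]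

/-- The derivative in the direction of a fixed vector. -/
def dirDeriv (v : E) (G : E → X) (y : E) : X := fderiv 𝕜 G y v

theorem ContDiff.dirDeriv {G : E → X} (hG : ContDiff 𝕜 ∞ G) (v : E) :
    ContDiff 𝕜 ∞ (dirDeriv (𝕜 := 𝕜) v G) :=
  hG.fderiv_infty.clm_apply contDiff_const

theorem ContDiff.foldr_dirDeriv {G : E → X} (hG : ContDiff 𝕜 ∞ G) (L : List E) :
    ContDiff 𝕜 ∞ (L.foldr (_root_.dirDeriv (𝕜 := 𝕜)) G) := by
  induction L with
  | nil => exact hG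
  | cons v L ih => exact ih.dirDeriv v

theorem dirDeriv_comm {G : E → X} (hG : ContDiff 𝕜 ∞ G) (v w : E) :
    dirDeriv (𝕜 := 𝕜) v (dirDeriv (𝕜 := 𝕜) w G) =
      dirDeriv (𝕜 := 𝕜) w (dirDeriv (𝕜 := 𝕜) v G) := by
  funext y
  have hsymm : IsSymmSndFDerivAt 𝕜 G y := hG.contDiffAt.isSymmSndFDerivAt (by
    rw [minSmoothness_of_isRCLikeNormedField]
    exact WithTop.coe_le_coe.2 (le_top : (2 : ℕ∞) ≤ ⊤))
  have hd : DifferentiableAt 𝕜 (fderiv 𝕜 G) y :=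
    (hG.fderiv_infty.differentiable (by simp)).differentiableAt
  have key : ∀ v w : E, dirDeriv (𝕜 := 𝕜) v (dirDeriv (𝕜 := 𝕜) w G) y =
      fderiv 𝕜 (fderiv 𝕜 G) y v w := fun v w => by
    unfold dirDeriv
    rw [fderiv_clm_apply hd (differentiableAt_const _)]
    simp
  rw [key, key, hsymm]

theorem List.Perm.foldr_dirDeriv {G : E → X} (hG : ContDiff 𝕜 ∞ G) {L L' : List E}
    (h : L.Perm L') : L.foldr (dirDeriv (𝕜 := 𝕜)) G = L'.foldr (dirDeriv (𝕜 := 𝕜)) G := by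
  induction h with
  | nil => rfl
  | cons v _ ih => rw [List.foldr_cons, List.foldr_cons, ih]
  | swap v w L => exact dirDeriv_comm (hG.foldr_dirDeriv L) _ _
  | trans _ _ h₁ h₂ => exact h₁.trans h₂

theorem iteratedFDeriv_eq_foldr {G : E → X} (hG : ContDiff 𝕜 ∞ G) {k : ℕ} (m : Fin k → E)
    (y : E) : iteratedFDeriv 𝕜 k G y m = (List.ofFn m).foldr (dirDeriv (𝕜 := 𝕜)) G y := by
  induction k generalizing y with
  | zero => rfl
  | succ k ih =>
    have hd : DifferentiableAt 𝕜 (iteratedFDeriv 𝕜 k G) y :=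
      (hG.differentiable_iteratedFDeriv
        (by exact_mod_cast ENat.natCast_lt_top _)).differentiableAt
    rw [hd.iteratedFDeriv_succ_apply_left', List.ofFn_succ, List.foldr_cons,
      funext (ih (Fin.tail m))]
    rfl

theorem ContDiff.iteratedFDeriv_comp_perm_infty {G : E → X} (hG : ContDiff 𝕜 ∞ G) {k : ℕ}
    (m : Fin k → E) (σ : Equiv.Perm (Fin k)) (y : E) :
    iteratedFDeriv 𝕜 k G y (m ∘ σ) = iteratedFDeriv 𝕜 k G y m := by
  rw [iteratedFDeriv_eq_foldr hG, iteratedFDeriv_eq_foldr hG,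
    (Equiv.Perm.ofFn_comp_perm σ m).foldr_dirDeriv hG]

end Directional

theorem multiPartial_eq_foldr {G : (Fin d → 𝕜) → X} (hG : ContDiff 𝕜 ∞ G)
    (I : Multiset (Fin d)) (y : Fin d → 𝕜) :
    multiPartial I G y =
      (I.sort.map fun i => (Pi.single i 1 : Fin d → 𝕜)).foldr (dirDeriv (𝕜 := 𝕜)) G y := by
  rw [multiPartial, iteratedFDeriv_eq_foldr hG]
  exact congrArg (fun L : List (Fin d → 𝕜) => L.foldr (dirDeriv (𝕜 := 𝕜)) G y)
    (List.ofFn_getElem_eq_map I.sort fun i => (Pi.single i 1 : Fin d → 𝕜))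

theorem multiPartial_zero (G : (Fin d → 𝕜) → X) (y : Fin d → 𝕜) : multiPartial 0 G y = G y := by
  have h : (0 : Multiset (Fin d)).sort = [] := Multiset.sort_zero _
  unfold multiPartial
  rw [h]
  rfl

theorem multiPartial_cons {G : (Fin d → 𝕜) → X} (hG : ContDiff 𝕜 ∞ G) (i : Fin d)
    (I : Multiset (Fin d)) (y : Fin d → 𝕜) :
    multiPartial (i ::ₘ I) G y = multiPartial I (fderiv 𝕜 G) y (Pi.single i 1) := by
  have hperm : ((i ::ₘ I).sort).Perm (I.sort ++ [i]) := by
    rw [← Multiset.coe_eq_coe, Multiset.sort_eq, ← Multiset.coe_add, Multiset.sort_eq,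
      Multiset.coe_singleton, add_comm, Multiset.singleton_add]
  rw [multiPartial_eq_foldr hG, (hperm.map _).foldr_dirDeriv hG, List.map_append,
    List.foldr_append]
  change List.foldr _ (dirDeriv (𝕜 := 𝕜) (Pi.single i 1) G) _ y = _
  rw [← multiPartial_eq_foldr (hG.dirDeriv _)]
  have h := ContinuousLinearMap.iteratedFDeriv_comp_left (i := I.sort.length)
    (ContinuousLinearMap.apply 𝕜 X (Pi.single i 1 : Fin d → 𝕜))
    (hG.fderiv_infty.contDiffAt (x := y)) (by exact_mod_cast le_top)
  exact congrArg (fun M => M fun j => Pi.single (I.sort.get j) 1) h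

namespace AromaticForest

theorem elementalOp_one (f : (Fin d → 𝕜) → (Fin d → 𝕜)) (G : (Fin d → 𝕜) → X)
    (y : Fin d → 𝕜) : (1 : AromaticForest).elementalOp f G y = G y := by
  rw [← of_eq_one (Fin.elim0 : AromaticGraph (Fin 0)), elementalOp_of,
    AromaticGraph.elementalOp, Fintype.sum_unique, Fintype.prod_empty, one_smul]
  exact multiPartial_zero G y

/-- Concatenation with an aromatic tree `τ` is a derivative in the direction of the elemental
vector field of `τ`. -/
theorem elementalOp_tree_mul (τ : AromaticTree) (ψ : AromaticForest)
    (f : (Fin d → 𝕜) → (Fin d → 𝕜)) {G : (Fin d → 𝕜) → X} (hG : ContDiff 𝕜 ∞ G)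
    (y : Fin d → 𝕜) :
    (τ.1 * ψ).elementalOp f G y = ψ.elementalOp f (fderiv 𝕜 G) y (elementalField τ f y) := by
  classical
  obtain ⟨τ, hτ⟩ := τ
  unfold elementalField
  dsimp only
  induction τ using ind_of with
  | h V γ =>
  induction ψ using ind_of with
  | h W δ =>
  have := Fintype.ofFinite V
  have := Fintype.ofFinite W
  rw [numRoots_of, Finset.card_eq_one] at hτ
  obtain ⟨r, hr⟩ := hτ
  have hpl : ∀ p, (γ.disjointUnion δ).predecessors (.inl p) =
      (γ.predecessors p).map Function.Embedding.inl := fun p => by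
    ext (v | v) <;> simp only [predecessors, Finset.mem_filter, Finset.mem_univ, true_and,
      Finset.mem_map] <;> simp [AromaticGraph.disjointUnion]
  have hpr : ∀ p, (γ.disjointUnion δ).predecessors (.inr p) =
      (δ.predecessors p).map Function.Embedding.inr := fun p => by
    ext (v | v) <;> simp only [predecessors, Finset.mem_filter, Finset.mem_univ, true_and,
      Finset.mem_map] <;> simp [AromaticGraph.disjointUnion]
  set w₁ : (V → Fin d) → 𝕜 := fun i =>
    ∏ p : V, multiPartial ((γ.predecessors p).val.map i) (fun x => f x (i p)) y with hw₁
  set w₂ : (W → Fin d) → 𝕜 := fun i =>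
    ∏ p : W, multiPartial ((δ.predecessors p).val.map i) (fun x => f x (i p)) y with hw₂
  have hfield : (fun c => (of γ).elementalOp f (fun x => x c) y) =
      ∑ i : V → Fin d, w₁ i • (Pi.single (i r) 1 : Fin d → 𝕜) := by
    funext c
    rw [elementalOp_of, AromaticGraph.elementalOp, Finset.sum_apply]
    refine Finset.sum_congr rfl fun i _ => ?_
    have hc : ContDiff 𝕜 ∞ fun x : Fin d → 𝕜 => x c := contDiff_apply 𝕜 𝕜 c
    have hroots : γ.roots.val.map i = i r ::ₘ 0 := by rw [hr]; rfl
    rw [hroots, multiPartial_cons hc, multiPartial_zero, Pi.smul_apply]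
    congr 1
    exact congrArg (fun L : (Fin d → 𝕜) →L[𝕜] 𝕜 => L (Pi.single (i r) 1))
      (ContinuousLinearMap.fderiv (ContinuousLinearMap.proj (R := 𝕜) (φ := fun _ => 𝕜) c))
  rw [hfield, of_mul_of, elementalOp_of, elementalOp_of, AromaticGraph.elementalOp,
    AromaticGraph.elementalOp, _root_.sum_apply,
    ← (Equiv.sumArrowEquivProdArrow V W (Fin d)).symm.sum_comp, Fintype.sum_prod_type_right]
  refine Finset.sum_congr rfl fun i₂ _ => ?_
  rw [map_sum]
  refine Finset.sum_congr rfl fun i₁ _ => ?_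
  have hroots : (γ.disjointUnion δ).roots.val.map
      ((Equiv.sumArrowEquivProdArrow V W (Fin d)).symm (i₁, i₂)) =
      i₁ r ::ₘ δ.roots.val.map i₂ := by
    rw [roots_disjointUnion, Finset.val_disjSum, Multiset.disjSum, Multiset.map_add,
      Multiset.map_map, Multiset.map_map, hr]
    rfl
  rw [hroots, multiPartial_cons hG, Fintype.prod_sum_type, map_smul,
    _root_.smul_apply, smul_smul]
  congr 1
  congr 1
  · exact Finset.prod_congr rfl fun p _ => by
      rw [hpl, Finset.map_val, Multiset.map_map]
      rfl
  · exact Finset.prod_congr rfl fun p _ => by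
      rw [hpr, Finset.map_val, Multiset.map_map]
      rfl

end AromaticForest

end Analysis

section Combinatorial

open AromaticForest

universe u

variable {𝕜 : Type} [RCLike 𝕜] {d : ℕ} {X : Type u} [NormedAddCommGroup X] [NormedSpace 𝕜 X]

theorem sum_antidiagonalTuple_succ {M : Type*} [AddCommMonoid M] (k n : ℕ)
    (F : (Fin (k + 1) → ℕ) → M) :
    ∑ m ∈ Finset.Nat.antidiagonalTuple (k + 1) n, F m =
      ∑ p ∈ Finset.HasAntidiagonal.antidiagonal n, ∑ m ∈ Finset.Nat.antidiagonalTuple k p.2,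
        F (Fin.snoc m p.1) := by
  rw [Finset.sum_sigma']
  refine Finset.sum_bij' (fun m _ => ⟨(m (Fin.last k), ∑ j, Fin.init m j), Fin.init m⟩)
    (fun x _ => Fin.snoc x.2 x.1.1) ?_ ?_ ?_ ?_ ?_
  · intro m hm
    rw [Finset.Nat.mem_antidiagonalTuple, Fin.sum_univ_castSucc] at hm
    simp only [Finset.mem_sigma, Finset.HasAntidiagonal.mem_antidiagonal, Finset.Nat.mem_antidiagonalTuple,
      and_true]
    rw [← hm, add_comm]
    rfl
  · rintro ⟨⟨n₁, n₂⟩, m⟩ hm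
    simp only [Finset.mem_sigma, Finset.HasAntidiagonal.mem_antidiagonal,
      Finset.Nat.mem_antidiagonalTuple] at hm ⊢
    rw [Fin.sum_univ_castSucc]
    simp [hm.2, ← hm.1, add_comm]
  · intro m _
    exact Fin.snoc_init_self m
  · rintro ⟨⟨n₁, n₂⟩, m⟩ hm
    simp only [Finset.mem_sigma, Finset.HasAntidiagonal.mem_antidiagonal,
      Finset.Nat.mem_antidiagonalTuple] at hm
    simp [hm.2]
  · intro m _
    rw [Fin.snoc_init_self]

/-- The coefficient of `h ^ n` in `M(R, …, R)`, where `R = ∑ h ^ m c_m` and `M` is a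
multilinear map. -/
def multilinearCoeff {k : ℕ} {E : Type*} [NormedAddCommGroup E] [NormedSpace 𝕜 E]
    (M : E [×k]→L[𝕜] X) (c : ℕ → E) (n : ℕ) : X :=
  ∑ m ∈ Finset.Nat.antidiagonalTuple k n, M fun j => c (m j)

theorem multilinearCoeff_zero {E : Type*} [NormedAddCommGroup E] [NormedSpace 𝕜 E]
    (M : E [×0]→L[𝕜] X) (c : ℕ → E) (n : ℕ) :
    multilinearCoeff M c n = if n = 0 then M 0 else 0 := by
  rw [multilinearCoeff]
  cases n with
  | zero =>
    rw [Finset.Nat.antidiagonalTuple_zero_zero, Finset.sum_singleton, if_pos rfl]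
    exact congrArg M (Subsingleton.elim _ _)
  | succ n =>
    rw [Finset.Nat.antidiagonalTuple_zero_succ, Finset.sum_empty, if_neg n.succ_ne_zero]

theorem multilinearCoeff_succ {k : ℕ} {E : Type*} [NormedAddCommGroup E] [NormedSpace 𝕜 E]
    (M : E [×(k + 1)]→L[𝕜] X) (c : ℕ → E) (n : ℕ) :
    multilinearCoeff M c n =
      ∑ p ∈ Finset.HasAntidiagonal.antidiagonal n, multilinearCoeff M.curryRight c p.2 (c p.1) := by
  rw [multilinearCoeff, sum_antidiagonalTuple_succ]
  refine Finset.sum_congr rfl fun p _ => ?_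
  rw [multilinearCoeff, _root_.sum_apply]
  refine Finset.sum_congr rfl fun m _ => ?_
  rw [ContinuousMultilinearMap.curryRight_apply]
  congr 1
  funext j
  induction j using Fin.lastCases <;> simp

theorem multilinearCoeff_eq_zero {k : ℕ} {E : Type*} [NormedAddCommGroup E] [NormedSpace 𝕜 E]
    (M : E [×k]→L[𝕜] X) {c : ℕ → E} (hc : c 0 = 0) {n : ℕ} (hn : n < k) :
    multilinearCoeff M c n = 0 := by
  refine Finset.sum_eq_zero fun m hm => ?_
  rw [Finset.Nat.mem_antidiagonalTuple] at hm
  obtain ⟨j, hj⟩ : ∃ j, m j = 0 := by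
    by_contra! h
    have : ∑ _j : Fin k, 1 ≤ ∑ j, m j :=
      Finset.sum_le_sum fun j _ => Nat.one_le_iff_ne_zero.2 (h j)
    simp at this
    omega
  exact M.map_coord_zero j (by rw [hj, hc])

theorem curryRight_iteratedFDeriv {E : Type*} [NormedAddCommGroup E] [NormedSpace 𝕜 E] (k : ℕ)
    (G : E → X) (y : E) :
    (iteratedFDeriv 𝕜 (k + 1) G y).curryRight = iteratedFDeriv 𝕜 k (fderiv 𝕜 G) y := by
  ext m v
  rw [ContinuousMultilinearMap.curryRight_apply, iteratedFDeriv_succ_apply_right,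
    Fin.init_snoc, Fin.snoc_last]

/-- In the coefficients of a formal composition, the range of the order of derivation can be
enlarged, and factors of order zero need not be excluded. -/
theorem formalComp_eq_sum (G : (Fin d → 𝕜) → X) {Y c : ℕ → Fin d → 𝕜} (hc0 : c 0 = 0)
    (hc : ∀ n ≠ 0, c n = Y n) {n N : ℕ} (hn : n ≤ N) :
    formalComp 𝕜 G Y n = ∑ k ∈ Finset.range (N + 1),
      (k.factorial : 𝕜)⁻¹ • multilinearCoeff (iteratedFDeriv 𝕜 k G (Y 0)) c n := by
  have hsub : Finset.range (n + 1) ⊆ Finset.range (N + 1) :=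
    Finset.range_subset_range.2 (by omega)
  rw [formalComp, ← Finset.sum_subset hsub]
  · refine Finset.sum_congr rfl fun k _ => ?_
    rw [multilinearCoeff]
    congr 1
    rw [Finset.sum_filter]
    refine Finset.sum_congr rfl fun m _ => ?_
    split_ifs with h
    · exact congrArg _ (funext fun j => (hc _ (h j)).symm)
    · push Not at h
      obtain ⟨j, hj⟩ := h
      exact ((iteratedFDeriv 𝕜 k G (Y 0)).map_coord_zero j (by rw [hj, hc0])).symm
  · intro k _ hk
    rw [multilinearCoeff_eq_zero _ hc0 (by simpa using hk), smul_zero]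

/-- The part of the coefficient of `h ^ n` of an S-series that belongs to the forests with `k`
roots. -/
def sSeriesPart (k : ℕ) (f : (Fin d → 𝕜) → (Fin d → 𝕜)) (b : AromaticForest → 𝕜)
    (G : (Fin d → 𝕜) → X) (y : Fin d → 𝕜) (n : ℕ) : X :=
  ∑ φ ∈ ofSize n with φ.numRoots = k, (b φ / (φ.sigma : 𝕜)) • φ.elementalOp f G y

theorem sSeries_eq_sum (f : (Fin d → 𝕜) → (Fin d → 𝕜)) (b : AromaticForest → 𝕜)
    (G : (Fin d → 𝕜) → X) (y : Fin d → 𝕜) (n : ℕ) :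
    sSeries f b G y n = ∑ k ∈ Finset.range (n + 1), sSeriesPart k f b G y n := by
  refine (Finset.sum_fiberwise_of_maps_to (fun φ hφ => ?_) _).symm
  have := φ.numRoots_le_size
  rw [mem_ofSize.1 hφ] at this
  exact Finset.mem_range.2 (by omega)

theorem bSeries_zero (f : (Fin d → 𝕜) → (Fin d → 𝕜)) (a : AromaticTree → 𝕜) (y : Fin d → 𝕜) :
    bSeries f a y 0 = 0 := by
  refine Finset.sum_eq_zero fun τ hτ => ?_
  have h := τ.2
  rw [eq_one_of_size_eq_zero (mem_ofSize.1 (Finset.mem_subtype.1 hτ)), numRoots_one] at h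
  omega

theorem IsMultiplicativeExtension.sSeriesPart_zero {a : AromaticTree → 𝕜}
    {b : AromaticForest → 𝕜} (h : IsMultiplicativeExtension a b)
    (f : (Fin d → 𝕜) → (Fin d → 𝕜)) (G : (Fin d → 𝕜) → X) (y : Fin d → 𝕜) (n : ℕ) :
    sSeriesPart 0 f b G y n = if n = 0 then G y else 0 := by
  have h1 : ∀ φ ∈ (ofSize n).filter fun φ => φ.numRoots = 0, φ ≠ 1 →
      (b φ / (φ.sigma : 𝕜)) • φ.elementalOp f G y = 0 := fun φ hφ hne => by
    rw [h.apply_rootless (Finset.mem_filter.1 hφ).2, if_neg hne, zero_div, zero_smul]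
  split_ifs with hn
  · have hmem : (1 : AromaticForest) ∈ (ofSize n).filter fun φ => φ.numRoots = 0 :=
      Finset.mem_filter.2 ⟨mem_ofSize.2 hn.symm, numRoots_one⟩
    rw [sSeriesPart, Finset.sum_eq_single_of_mem 1 hmem h1, h.apply_rootless numRoots_one,
      if_pos rfl, sigma_one, Nat.cast_one, div_one, one_smul, elementalOp_one]
  · refine Finset.sum_eq_zero fun φ hφ => h1 φ hφ ?_
    rintro rfl
    exact hn (mem_ofSize.1 (Finset.mem_filter.1 hφ).1).symm

theorem IsMultiplicativeExtension.sSeriesPart_succ {a : AromaticTree → 𝕜}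
    {b : AromaticForest → 𝕜} (h : IsMultiplicativeExtension a b)
    (f : (Fin d → 𝕜) → (Fin d → 𝕜)) {G : (Fin d → 𝕜) → X} (hG : ContDiff 𝕜 ∞ G)
    (y : Fin d → 𝕜) (k n : ℕ) :
    ((k + 1 : ℕ) : 𝕜) • sSeriesPart (k + 1) f b G y n = ∑ q ∈ Finset.HasAntidiagonal.antidiagonal n,
      sSeriesPart k f b (fderiv 𝕜 G) y q.2 (bSeries f a y q.1) := by
  classical
  let K : AromaticForest → AromaticForest → X := fun φ ψ =>
    (treeExtension a φ * b ψ / ((φ.sigma : 𝕜) * ψ.sigma)) • (φ * ψ).elementalOp f G y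
  have hl : ((k + 1 : ℕ) : 𝕜) • sSeriesPart (k + 1) f b G y n =
      ∑ φ ∈ ofSize n with φ.numRoots = k + 1,
        ∑ p ∈ φ.factorizations with p.1.numRoots = 1, K p.1 p.2 := by
    rw [sSeriesPart, Finset.smul_sum]
    refine Finset.sum_congr rfl fun φ hφ => ?_
    have hσ : (φ.sigma : 𝕜) ≠ 0 := Nat.cast_ne_zero.2 φ.sigma_pos.ne'
    rw [← (Finset.mem_filter.1 hφ).2, smul_smul, ← mul_div_assoc, h.numRoots_mul_apply,
      mul_div_cancel_left₀ _ hσ, Finset.sum_smul, Finset.sum_filter_of_ne]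
    · refine Finset.sum_congr rfl fun p hp => ?_
      rw [← mem_factorizations.1 hp]
    · intro p _ hp
      by_contra hne
      exact hp (by simp only [K, treeExtension, dif_neg hne, zero_mul, zero_div, zero_smul])
  have hr : ∀ q : ℕ × ℕ, sSeriesPart k f b (fderiv 𝕜 G) y q.2 (bSeries f a y q.1) =
      ∑ τ ∈ ofSize q.1 with τ.numRoots = 1, ∑ ψ ∈ ofSize q.2 with ψ.numRoots = k, K τ ψ := by
    intro q
    rw [← Finset.sum_subtype_eq_sum_filter, bSeries, map_sum]
    refine Finset.sum_congr rfl fun τ _ => ?_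
    rw [sSeriesPart, _root_.sum_apply]
    refine Finset.sum_congr rfl fun ψ _ => ?_
    simp only [K]
    rw [elementalOp_tree_mul τ ψ f hG, _root_.smul_apply, map_smul, smul_smul,
      treeExtension_tree]
    congr 1
    ring
  rw [hl, Finset.sum_congr rfl fun q _ => hr q]
  simp only [← Finset.sum_product']
  rw [Finset.sum_sigma', Finset.sum_sigma']
  refine Finset.sum_nbij' (fun x => ⟨(x.2.1.size, x.2.2.size), x.2⟩)
    (fun x => ⟨x.2.1 * x.2.2, x.2⟩) ?_ ?_ ?_ ?_ ?_
  · rintro ⟨φ, p⟩ hx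
    simp only [Finset.mem_sigma, Finset.mem_filter, mem_ofSize, mem_factorizations,
      Finset.HasAntidiagonal.mem_antidiagonal, Finset.mem_product] at hx ⊢
    obtain ⟨⟨hn, hk⟩, rfl, hp⟩ := hx
    rw [numRoots_mul] at hk
    exact ⟨hn, ⟨trivial, hp⟩, trivial, by omega⟩
  · rintro ⟨q, p⟩ hx
    simp only [Finset.mem_sigma, Finset.mem_filter, mem_ofSize, mem_factorizations,
      Finset.HasAntidiagonal.mem_antidiagonal, Finset.mem_product] at hx ⊢
    obtain ⟨hq, ⟨h₁, h₂⟩, h₃, h₄⟩ := hx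
    refine ⟨⟨?_, ?_⟩, trivial, h₂⟩
    · rw [size_mul, h₁, h₃, hq]
    · rw [numRoots_mul, h₂, h₄, add_comm]
  · rintro ⟨φ, p⟩ hx
    simp only [Finset.mem_sigma, Finset.mem_filter, mem_factorizations] at hx
    obtain ⟨_, rfl, _⟩ := hx
    rfl
  · rintro ⟨⟨n₁, n₂⟩, p⟩ hx
    simp only [Finset.mem_sigma, Finset.mem_filter, mem_ofSize, Finset.mem_product] at hx
    obtain ⟨_, ⟨rfl, _⟩, rfl, _⟩ := hx
    rfl
  · exact fun _ _ => rfl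

theorem IsMultiplicativeExtension.factorial_smul_sSeriesPart {a : AromaticTree → 𝕜}
    {b : AromaticForest → 𝕜} (h : IsMultiplicativeExtension a b)
    (f : (Fin d → 𝕜) → (Fin d → 𝕜)) {G : (Fin d → 𝕜) → X} (hG : ContDiff 𝕜 ∞ G)
    (y : Fin d → 𝕜) (k n : ℕ) :
    (k.factorial : 𝕜) • sSeriesPart k f b G y n =
      multilinearCoeff (iteratedFDeriv 𝕜 k G y) (bSeries f a y) n := by
  induction k generalizing X n with
  | zero =>
    rw [h.sSeriesPart_zero, multilinearCoeff_zero, Nat.factorial_zero, Nat.cast_one, one_smul]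
    rfl
  | succ k ih =>
    rw [multilinearCoeff_succ, Nat.factorial_succ, mul_comm, Nat.cast_mul, mul_smul,
      h.sSeriesPart_succ f hG, Finset.smul_sum, curryRight_iteratedFDeriv]
    refine Finset.sum_congr rfl fun q _ => ?_
    rw [← ih hG.fderiv_infty]
    rfl

theorem IsMultiplicativeExtension.formalComp_eq_sSeries {a : AromaticTree → 𝕜}
    {b : AromaticForest → 𝕜} (h : IsMultiplicativeExtension a b)
    (f : (Fin d → 𝕜) → (Fin d → 𝕜)) {G : (Fin d → 𝕜) → X} (hG : ContDiff 𝕜 ∞ G)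
    (y : Fin d → 𝕜) : formalComp 𝕜 G (shiftedBSeries f a y) = sSeries f b G y := by
  funext n
  have h0 : shiftedBSeries f a y 0 = y := by
    rw [shiftedBSeries, bSeries_zero, if_pos rfl, add_zero]
  rw [sSeries_eq_sum, formalComp_eq_sum G (bSeries_zero f a y)
    (fun n hn => by rw [shiftedBSeries, if_neg hn, zero_add]) le_rfl, h0]
  refine Finset.sum_congr rfl fun k _ => ?_
  rw [← h.factorial_smul_sSeriesPart f hG,
    inv_smul_smul₀ (Nat.cast_ne_zero.2 k.factorial_ne_zero)]

end Combinatorial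

section Expansion

universe u

variable {𝕜 : Type} [RCLike 𝕜] {X : Type u} [NormedAddCommGroup X] [NormedSpace 𝕜 X]
  {E : Type} [NormedAddCommGroup E] [NormedSpace 𝕜 E]

theorem hasFDerivAt_iteratedFDeriv_diag {G : E → X} (hG : ContDiff 𝕜 ∞ G) (k : ℕ) (y x : E) :
    HasFDerivAt (fun x => iteratedFDeriv 𝕜 (k + 1) G y fun _ => x - y)
      (((k + 1 : ℕ) : 𝕜) • iteratedFDeriv 𝕜 k (fderiv 𝕜 G) y fun _ => x - y) x := by
  classical
  set M := iteratedFDeriv 𝕜 (k + 1) G y with hM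
  have hg : ∀ _ : Fin (k + 1), HasFDerivAt (fun x => x - y) (ContinuousLinearMap.id 𝕜 E) x :=
    fun _ => (hasFDerivAt_id x).sub_const y
  refine (HasFDerivAt.multilinear_comp (f := M) hg).congr_fderiv ?_
  ext v
  rw [_root_.sum_apply, _root_.smul_apply, ← curryRight_iteratedFDeriv,
    ContinuousMultilinearMap.curryRight_apply, ← hM]
  have hi : ∀ i : Fin (k + 1), ((M.toContinuousLinearMap (fun _ => x - y) i).comp
      (ContinuousLinearMap.id 𝕜 E)) v = M (Fin.snoc (fun _ => x - y) v) := by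
    intro i
    change M (Function.update (fun _ => x - y) i v) = _
    rw [hM, ← hG.iteratedFDeriv_comp_perm_infty _ (Equiv.swap i (Fin.last k))]
    congr 1
    funext j
    simp only [Function.comp_apply, Function.update_apply]
    induction j using Fin.lastCases with
    | last => simp
    | cast j =>
      rw [Fin.snoc_castSucc, if_neg]
      rw [Equiv.swap_apply_eq_iff, Equiv.swap_apply_left]
      exact (Fin.castSucc_lt_last j).ne
  rw [Finset.sum_congr rfl fun i _ => hi i, Finset.sum_const, Finset.card_univ, Fintype.card_fin,
    Nat.cast_smul_eq_nsmul]

/-- A function whose derivative is `O(‖x - y‖ ^ n)` and which vanishes at `y` is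
`O(‖x - y‖ ^ (n + 1))`. -/
theorem isBigO_pow_succ_of_hasFDerivAt {R : E → X} {R' : E → E →L[𝕜] X} {y : E} {n : ℕ}
    (hR : ∀ x, HasFDerivAt R (R' x) x) (h0 : R y = 0)
    (hO : R' =O[𝓝 y] fun x => ‖x - y‖ ^ n) : R =O[𝓝 y] fun x => ‖x - y‖ ^ (n + 1) := by
  let : NormedSpace ℝ E := NormedSpace.restrictScalars ℝ 𝕜 E
  obtain ⟨C, hC⟩ := hO.bound
  obtain ⟨ε, hε, hball⟩ := Metric.eventually_nhds_iff_ball.1 hC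
  refine IsBigO.of_bound C (Metric.eventually_nhds_iff_ball.2 ⟨ε, hε, fun x hx => ?_⟩)
  rw [mem_ball_iff_norm] at hx
  have hsub : ∀ z ∈ Metric.closedBall y ‖x - y‖, ‖R' z‖ ≤ C * ‖x - y‖ ^ n := by
    intro z hz
    rw [mem_closedBall_iff_norm] at hz
    have hb := hball z (mem_ball_iff_norm.2 (hz.trans_lt hx))
    rw [norm_pow, norm_norm] at hb
    by_cases hCn : 0 ≤ C
    · exact hb.trans (by gcongr)
    · have hz0 : ‖z - y‖ ^ n = 0 := by
        have h1 : 0 ≤ ‖z - y‖ ^ n := by positivity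
        have h2 := (norm_nonneg _).trans hb
        nlinarith
      have hx0 : ‖x - y‖ ^ n ≤ 0 := by
        by_contra! hpos
        have hb' := hball x (mem_ball_iff_norm.2 hx)
        rw [norm_pow, norm_norm] at hb'
        have h2 := (norm_nonneg _).trans hb'
        nlinarith
      have hx1 : ‖x - y‖ ^ n = 0 := le_antisymm hx0 (by positivity)
      rw [hx1]
      rwa [hz0] at hb
  have hmv := (convex_closedBall y ‖x - y‖).norm_image_sub_le_of_norm_hasFDerivWithin_le
    (fun z _ => (hR z).hasFDerivWithinAt) hsub (Metric.mem_closedBall_self (norm_nonneg _))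
    (mem_closedBall_iff_norm.2 le_rfl)
  rw [h0, sub_zero] at hmv
  rw [norm_pow, norm_norm, pow_succ, ← mul_assoc]
  exact hmv

/-- **Taylor's theorem** for smooth maps between normed spaces over `ℝ` or `ℂ`. -/
theorem ContDiff.isBigO_sub_taylor {G : E → X} (hG : ContDiff 𝕜 ∞ G) (y : E) (N : ℕ) :
    (fun x => G x - ∑ k ∈ Finset.range (N + 1),
      (k.factorial : 𝕜)⁻¹ • iteratedFDeriv 𝕜 k G y fun _ => x - y) =O[𝓝 y]
      fun x => ‖x - y‖ ^ (N + 1) := by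
  induction N generalizing X with
  | zero =>
    have hd : DifferentiableAt 𝕜 G y := (hG.differentiable (by simp)).differentiableAt
    simpa using hd.isBigO_sub.norm_right
  | succ N ih =>
    refine isBigO_pow_succ_of_hasFDerivAt (R' := fun x => fderiv 𝕜 G x -
      ∑ k ∈ Finset.range (N + 1), (k.factorial : 𝕜)⁻¹ •
        iteratedFDeriv 𝕜 k (fderiv 𝕜 G) y fun _ => x - y) (fun x => ?_) ?_ (ih hG.fderiv_infty)
    · refine (hG.differentiable (by simp)).differentiableAt.hasFDerivAt.sub ?_
      simp only [Finset.sum_range_succ' _ (N + 1)]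
      simp only [iteratedFDeriv_zero_apply]
      refine HasFDerivAt.add_const _ (HasFDerivAt.fun_sum fun k _ => ?_)
      refine ((hasFDerivAt_iteratedFDeriv_diag hG k y x).const_smul _).congr_fderiv ?_
      rw [smul_smul]
      congr 1
      rw [Nat.factorial_succ, Nat.cast_mul, mul_inv, mul_comm, ← mul_assoc,
        mul_inv_cancel₀ (Nat.cast_ne_zero.2 k.succ_ne_zero), one_mul]
    · rw [Finset.sum_range_succ', Finset.sum_eq_zero, zero_add]
      · simp
      · intro k _
        rw [ContinuousMultilinearMap.map_coord_zero _ 0 (sub_self y), smul_zero]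

namespace HasExpansionUpTo

variable {N : ℕ}

theorem congr_coeff {u : 𝕜 → X} {c c' : ℕ → X} (h : HasExpansionUpTo 𝕜 u c N)
    (hc : ∀ n ≤ N, c n = c' n) : HasExpansionUpTo 𝕜 u c' N := by
  refine h.congr_left fun h => ?_
  congr 1
  exact Finset.sum_congr rfl fun n hn => by rw [hc n (by simpa [Nat.lt_succ_iff] using hn)]

theorem congr_fun {u v : 𝕜 → X} {c : ℕ → X} (h : HasExpansionUpTo 𝕜 u c N)
    (huv : ∀ h, u h = v h) : HasExpansionUpTo 𝕜 v c N := funext huv ▸ h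

theorem const (x : X) : HasExpansionUpTo 𝕜 (fun _ => x) (fun n => if n = 0 then x else 0) N := by
  refine (isBigO_zero _ _).congr_left fun h => ?_
  rw [Finset.sum_eq_single_of_mem 0 (by simp) fun n _ hn => by
    simp only [if_neg hn, smul_zero]]
  simp

theorem sum {ι : Type*} {s : Finset ι} {u : ι → 𝕜 → X} {c : ι → ℕ → X}
    (h : ∀ i ∈ s, HasExpansionUpTo 𝕜 (u i) (c i) N) :
    HasExpansionUpTo 𝕜 (fun h => ∑ i ∈ s, u i h) (fun n => ∑ i ∈ s, c i n) N := by
  refine (IsBigO.sum h).congr_left fun h => ?_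
  simp only [Finset.sum_apply, Finset.smul_sum]
  rw [Finset.sum_sub_distrib, Finset.sum_comm]

theorem const_smul {u : 𝕜 → X} {c : ℕ → X} (h : HasExpansionUpTo 𝕜 u c N) (r : 𝕜) :
    HasExpansionUpTo 𝕜 (fun h => r • u h) (fun n => r • c n) N := by
  refine (IsBigO.const_smul_left h r).congr_left fun h => ?_
  rw [Pi.smul_apply, smul_sub, Finset.smul_sum]
  congr 1
  exact Finset.sum_congr rfl fun n _ => smul_comm _ _ _

theorem add_isBigO {u v : 𝕜 → X} {c : ℕ → X} (h : HasExpansionUpTo 𝕜 u c N)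
    (hv : (fun h => v h - u h) =O[𝓝 0] fun h : 𝕜 => h ^ (N + 1)) : HasExpansionUpTo 𝕜 v c N := by
  refine (IsBigO.add hv h).congr_left fun h => ?_
  abel

theorem isBigO_polynomial (c : ℕ → X) (s : Finset ℕ) :
    (fun h : 𝕜 => ∑ n ∈ s, h ^ n • c n) =O[𝓝 0] fun _ : 𝕜 => (1 : 𝕜) := by
  have hc : Continuous fun h : 𝕜 => ∑ n ∈ s, h ^ n • c n := by fun_prop
  exact (hc.tendsto 0).isBigO_one 𝕜

theorem isBigO_pow_one (n : ℕ) : (fun h : 𝕜 => h ^ n) =O[𝓝 0] fun _ : 𝕜 => (1 : 𝕜) :=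
  ((continuous_pow n).tendsto (0 : 𝕜)).isBigO_one 𝕜

theorem isBigO_pow_pow {m n : ℕ} (h : n ≤ m) :
    (fun h : 𝕜 => h ^ m) =O[𝓝 0] fun h : 𝕜 => h ^ n := by
  obtain ⟨k, rfl⟩ := Nat.exists_eq_add_of_le h
  refine ((isBigO_refl (fun h : 𝕜 => h ^ n) (𝓝 0)).mul (isBigO_pow_one k)).congr ?_ ?_
  · exact fun h => (pow_add h n k).symm
  · exact fun h => mul_one _

theorem isBigO_one {u : 𝕜 → X} {c : ℕ → X} (h : HasExpansionUpTo 𝕜 u c N) :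
    u =O[𝓝 0] fun _ : 𝕜 => (1 : 𝕜) := by
  refine ((h.trans (isBigO_pow_one _)).add
    (isBigO_polynomial c (Finset.range (N + 1)))).congr_left fun h => ?_
  rw [sub_add_cancel]

theorem isBigO_id {u : 𝕜 → X} {c : ℕ → X} (h : HasExpansionUpTo 𝕜 u c N) (hc : c 0 = 0) :
    u =O[𝓝 0] fun h : 𝕜 => h := by
  have h1 : (fun h : 𝕜 => ∑ n ∈ Finset.range (N + 1), h ^ n • c n) =O[𝓝 0] fun h : 𝕜 => h := by
    refine IsBigO.fun_sum fun n _ => ?_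
    cases n with
    | zero =>
      refine (isBigO_zero _ _).congr_left fun h => ?_
      rw [hc, smul_zero]
    | succ n =>
      have h2 : (fun h : 𝕜 => h ^ (n + 1)) =O[𝓝 0] fun h : 𝕜 => h := by
        simpa using isBigO_pow_pow (𝕜 := 𝕜) (Nat.succ_le_succ n.zero_le)
      simpa using h2.smul
        (isBigO_const_const (c (n + 1)) (one_ne_zero (α := 𝕜)) (𝓝 (0 : 𝕜)))
  have h3 : (fun h : 𝕜 => h ^ (N + 1)) =O[𝓝 0] fun h : 𝕜 => h := by
    simpa using isBigO_pow_pow (𝕜 := 𝕜) (Nat.succ_le_succ N.zero_le)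
  refine ((h.trans h3).add h1).congr_left fun h => ?_
  rw [sub_add_cancel]

theorem isBigO_apply {Z : Type*} [NormedAddCommGroup Z] [NormedSpace 𝕜 Z] {u : 𝕜 → Z →L[𝕜] X}
    {r : 𝕜 → Z} {α β : 𝕜 → 𝕜} (hu : u =O[𝓝 0] α) (hr : r =O[𝓝 0] β) :
    (fun h => u h (r h)) =O[𝓝 0] fun h => α h * β h := by
  refine IsBigO.trans (IsBigO.of_bound 1 (Eventually.of_forall fun h => ?_))
    (hu.norm_left.mul hr.norm_left)
  rw [one_mul, norm_mul, norm_norm, norm_norm]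
  exact (u h).le_opNorm _

theorem clm_apply {Z : Type*} [NormedAddCommGroup Z] [NormedSpace 𝕜 Z] {u : 𝕜 → Z →L[𝕜] X}
    {a : ℕ → Z →L[𝕜] X} {r : 𝕜 → Z} {b : ℕ → Z} (hu : HasExpansionUpTo 𝕜 u a N)
    (hr : HasExpansionUpTo 𝕜 r b N) :
    HasExpansionUpTo 𝕜 (fun h => u h (r h))
      (fun n => ∑ p ∈ Finset.HasAntidiagonal.antidiagonal n, a p.2 (b p.1)) N := by
  have h1 := isBigO_apply hu hr.isBigO_one
  have h2 := isBigO_apply (isBigO_polynomial a (Finset.range (N + 1))) hr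
  simp only [mul_one, one_mul] at h1 h2
  let s := (Finset.range (N + 1) ×ˢ Finset.range (N + 1))
  have h3 : (fun h : 𝕜 => ∑ p ∈ s with ¬ p.1 + p.2 ≤ N, h ^ (p.1 + p.2) • a p.2 (b p.1)) =O[𝓝 0]
      fun h : 𝕜 => h ^ (N + 1) := by
    refine IsBigO.fun_sum fun p hp => ?_
    have hle : N + 1 ≤ p.1 + p.2 := not_le.1 (Finset.mem_filter.1 hp).2
    simpa using (isBigO_pow_pow (𝕜 := 𝕜) hle).smul
      (isBigO_const_const (a p.2 (b p.1)) (one_ne_zero (α := 𝕜)) (𝓝 (0 : 𝕜)))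
  refine ((h1.add h2).add h3).congr_left fun h => ?_
  have hprod : (∑ n ∈ Finset.range (N + 1), h ^ n • a n)
      (∑ n ∈ Finset.range (N + 1), h ^ n • b n) =
      ∑ p ∈ s, h ^ (p.1 + p.2) • a p.2 (b p.1) := by
    rw [map_sum, Finset.sum_product]
    refine Finset.sum_congr rfl fun i _ => ?_
    rw [_root_.sum_apply]
    refine Finset.sum_congr rfl fun j _ => ?_
    rw [_root_.smul_apply, map_smul, smul_smul, ← pow_add, add_comm]
  have hlow : ∑ n ∈ Finset.range (N + 1), h ^ n •
      ∑ p ∈ Finset.HasAntidiagonal.antidiagonal n, a p.2 (b p.1) =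
      ∑ p ∈ s with p.1 + p.2 ≤ N, h ^ (p.1 + p.2) • a p.2 (b p.1) := by
    simp only [Finset.smul_sum]
    rw [Finset.sum_sigma']
    refine Finset.sum_nbij' (fun x => x.2) (fun p => ⟨p.1 + p.2, p⟩) ?_ ?_ ?_ ?_ ?_
    · rintro ⟨n, p⟩ hx
      simp only [Finset.mem_sigma, Finset.mem_range, Finset.HasAntidiagonal.mem_antidiagonal,
        Finset.mem_filter, Finset.mem_product, s] at hx ⊢
      omega
    · intro p hx
      simp only [Finset.mem_sigma, Finset.mem_range, Finset.HasAntidiagonal.mem_antidiagonal,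
        Finset.mem_filter, Finset.mem_product, s] at hx ⊢
      exact ⟨by omega, trivial⟩
    · rintro ⟨n, p⟩ hx
      simp only [Finset.mem_sigma, Finset.HasAntidiagonal.mem_antidiagonal] at hx
      obtain ⟨_, rfl⟩ := hx
      rfl
    · exact fun _ _ => rfl
    · rintro ⟨n, p⟩ hx
      simp only [Finset.mem_sigma, Finset.HasAntidiagonal.mem_antidiagonal] at hx
      rw [hx.2]
  rw [hlow, map_sub, hprod, ← Finset.sum_filter_add_sum_filter_not s fun p => p.1 + p.2 ≤ N,
    _root_.sub_apply]
  abel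

theorem multilinear {r : 𝕜 → E} {c : ℕ → E} (hr : HasExpansionUpTo 𝕜 r c N) {k : ℕ}
    (M : E [×k]→L[𝕜] X) :
    HasExpansionUpTo 𝕜 (fun h => M fun _ => r h) (multilinearCoeff M c) N := by
  induction k generalizing X with
  | zero =>
    exact ((const (M 0)).congr_coeff fun n _ => (multilinearCoeff_zero M c n).symm).congr_fun
      fun h => congrArg M (Subsingleton.elim _ _)
  | succ k ih =>
    refine (((ih M.curryRight).clm_apply hr).congr_coeff
      fun n _ => (multilinearCoeff_succ M c n).symm).congr_fun fun h => ?_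
    rw [ContinuousMultilinearMap.curryRight_apply]
    congr 1
    funext j
    induction j using Fin.lastCases <;> simp

theorem comp_contDiff {d : ℕ} {G : (Fin d → 𝕜) → X} (hG : ContDiff 𝕜 ∞ G)
    {Y : 𝕜 → Fin d → 𝕜} {c : ℕ → Fin d → 𝕜} (hY : HasExpansionUpTo 𝕜 Y c N) :
    HasExpansionUpTo 𝕜 (fun h => G (Y h)) (formalComp 𝕜 G c) N := by
  set r : ℕ → Fin d → 𝕜 := fun n => if n = 0 then 0 else c n with hr
  have hR : HasExpansionUpTo 𝕜 (fun h => Y h - c 0) r N := by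
    refine hY.congr_left fun h => ?_
    rw [Finset.sum_range_succ', Finset.sum_range_succ']
    simp only [hr, Nat.succ_ne_zero, if_false, if_true, pow_zero, one_smul, add_zero]
    abel
  have hRid := hR.isBigO_id (if_pos rfl)
  have hlim : Tendsto Y (𝓝 0) (𝓝 (c 0)) := by
    rw [← tendsto_sub_nhds_zero_iff]
    exact hRid.trans_tendsto tendsto_id
  have htaylor := (hG.isBigO_sub_taylor (c 0) N).comp_tendsto hlim
  have hpow : (fun h => ‖Y h - c 0‖ ^ (N + 1)) =O[𝓝 0] fun h : 𝕜 => h ^ (N + 1) :=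
    hRid.norm_left.pow (N + 1)
  refine HasExpansionUpTo.add_isBigO ?_ (htaylor.trans hpow)
  refine (HasExpansionUpTo.sum fun k _ =>
    (hR.multilinear (iteratedFDeriv 𝕜 k G (c 0))).const_smul (k.factorial : 𝕜)⁻¹).congr_coeff
    fun n hn => ?_
  exact (formalComp_eq_sum G (if_pos rfl) (fun n hn => if_neg hn) hn).symm

end HasExpansionUpTo

end Expansion

end

theorem theorem4p2 {𝕜 : Type} [RCLike 𝕜] (a : AromaticTree → 𝕜) :
    (∃! abar : AromaticForest → 𝕜, IsMultiplicativeExtension a abar) ∧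
    ∀ abar : AromaticForest → 𝕜, IsMultiplicativeExtension a abar →
      ∀ {d : ℕ} {W : Type*} [NormedAddCommGroup W] [NormedSpace 𝕜 W]
        (f : (Fin d → 𝕜) → (Fin d → 𝕜)) (G : (Fin d → 𝕜) → W),
        ContDiff 𝕜 ∞ f → ContDiff 𝕜 ∞ G → ∀ y : Fin d → 𝕜,
          formalComp 𝕜 G (shiftedBSeries f a y) = sSeries f abar G y ∧
          ∀ (N : ℕ) (Y : 𝕜 → Fin d → 𝕜),
            HasExpansionUpTo 𝕜 Y (shiftedBSeries f a y) N →
              HasExpansionUpTo 𝕜 (fun h => G (Y h)) (sSeries f abar G y) N := by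
  refine ⟨existsUnique_isMultiplicativeExtension a, ?_⟩
  intro abar habar d W _ _ f G _ hG y
  have hformal := habar.formalComp_eq_sSeries f hG y
  exact ⟨hformal, fun N Y hY => hformal ▸ hY.comp_contDiff hG⟩
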